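/- Let $G$ be a connected graph with vertex set $V$, $|V|=N\ge 2$, and let $|\psi_G\rangle=\prod_{\{i,j\}\in E}\mathrm{CZ}^{\{i,j\}}|+\rangle^{\otimes N}$ be its graph state, with generators $G_i=X_i\bigotimes_{j\in n_i}Z_j$, where $n_i$ is the set of neighbours of $i$. Framework. Fix a proper colouring of $G$. The stabilizers used are the products $S^D=\prod_{i\in D}G_i$ over nonempty sets $D$ of vertices of one colour. Each is a tensor product of operators $X,Z,\mathbb I$, encoded by $s^D_i=1,-1,0$ according as its factor at $i$ is $X,Z,\mathbb I$. Choose a finite set $\mathcal P$ of (unordered) pairs of such stabilizers, a finite set $\mathcal R$ of such stabilizers and a set $\mathcal{AC}\subseteq V$ such that (1) for each pair $\{S^l,S^k\}\in\mathcal P$ there is $T\in\mathcal{AC}$ with $s^l_Ts^k_T=-1$ and $s^l_i=s^k_i=0$ for all $i\in\mathcal{AC}\setminus\{T\}$, and (2) $s^r_i=0$ for all $r\in\mathcal R$, $i\in\mathcal{AC}$. Each party $i$ has two observables $A_i,B_i$ with outcomes $\pm1$. The Bell expression is $$\mathcal B=\sum_{\{S^l,S^k\}\in\mathcal P}(\mathcal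 B_l+\mathcal B_k)+\sum_{r\in\mathcal R}\mathcal B_r,\qquad \mathcal B_j=\Big\langle\prod_{i\in\mathcal{AC},\,s^j_i\ne0}(A_i+s^j_iB_i)\prod_{i\notin\mathcal{AC}}P_i(s^j_i)\Big\rangle,$$ with $P_i(0)=\mathbb I$, $P_i(1)=A_i$, $P_i(-1)=B_i$. Let $\beta_C$ be its maximum over local hidden variable models and $\beta_Q$ its maximum over quantum realizations: local Hilbert spaces of arbitrary dimension, any state (pure or mixed) on their tensor product, and local self-adjoint $A_i,B_i$ with $A_i^2=B_i^2=\mathbb I$. Self-testing. $\mathcal B$ self-tests $|\psi_G\rangle$ if for every realization that attains $\beta_Q$ there are local isometries $\Phi_i:H_i\to\mathbb C^2\otimes H_i$, where $H_i$ is the Hilbert space of party $i$, that map the state to $|\psi_G\rangle$ tensored with an extra state, and map $A_i,B_i$ to $\frac{X_i+Z_i}{\sqrt2},\frac{X_i-Z_i}{\sqrt2}$ for $i\in\mathcal{AC}$ and to $X_i,Z_i$ for $i\notin\mathcal{AC}$. That is, when one of $\mathbb I,A_i,B_i$ is chosen at each party and applied to (a purification of) the state, $\bigotimes_i\Phi_i$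 takes the result to the corresponding reference operators applied to $|\psi_G\rangle$, tensored with the extra state. Claim. For every proper colouring of $G$ whose number of colours is the chromatic number of $G$, there is a choice of $\mathcal P,\mathcal R,\mathcal{AC}$ as above for which, after expansion, $\mathcal B$ contains exactly $2N$ distinct correlators with nonzero coefficient, $\beta_C$ and $\beta_Q$ are attained, $\beta_C>0$, $\beta_Q/\beta_C=\sqrt2$, and $\mathcal B$ self-tests $|\psi_G\rangle$. This ratio is maximal in the framework: for every proper colouring of $G$ and every choice of $\mathcal P,\mathcal R,\mathcal{AC}$ as above, $\beta_Q\le\sqrt2\,\beta_C$. -/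

import Mathlib

noncomputable section

namespace StabBell

/-! ## Hilbert spaces and tensor products -/

/-- The Hilbert space `ℓ²(α)`. Up to the choice of an orthonormal basis, every complex Hilbert
space is of this form. -/
abbrev L2 (α : Type) : Type := lp (fun _ : α => ℂ) 2

section TensorProduct

variable {V : Type} [DecidableEq V] {κ : V → Type}

/-- The restriction of `f ∈ ℓ²(∏ i, κ i)` to the line through `y` in direction `i`. -/
def slice (i : V) (f : L2 (∀ i, κ i)) (y : ∀ i, κ i) : L2 (κ i) :=
  ⟨fun a => f (Function.update y i a), by
    have h := (lp.memℓp f).summable (by norm_num)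
    exact memℓp_gen (h.comp_injective (Function.update_injective y i))⟩

theorem slice_apply (i : V) (f : L2 (∀ i, κ i)) (y : ∀ i, κ i) (a : κ i) :
    slice i f y a = f (Function.update y i a) := rfl

theorem piSplitAt_symm_eq_update (i : V) (y : ∀ i, κ i) (a : κ i) :
    (Equiv.piSplitAt i κ).symm (a, fun j => y j) = Function.update y i a := by
  apply (Equiv.piSplitAt i κ).injective
  rw [Equiv.apply_symm_apply]
  ext j
  · simp [Equiv.piSplitAt]
  · simp [Equiv.piSplitAt, Function.update_of_ne j.2]

theorem hasSum_sq (α : Type) (f : L2 α) : HasSum (fun x => ‖f x‖ ^ 2) (‖f‖ ^ 2) := by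
  have h := lp.hasSum_norm (p := 2) (by norm_num) f
  simpa using h

/-- One local operator acting on a vector of `ℓ²(∏ i, κ i)`: the function it produces. -/
def siteFun (i : V) (T : L2 (κ i) →L[ℂ] L2 (κ i)) (f : L2 (∀ i, κ i)) (y : ∀ i, κ i) : ℂ :=
  T (slice i f y) (y i)

theorem siteFun_bound (i : V) (T : L2 (κ i) →L[ℂ] L2 (κ i)) (f : L2 (∀ i, κ i)) :
    Summable (fun y => ‖siteFun i T f y‖ ^ 2) ∧
      ∑' y, ‖siteFun i T f y‖ ^ 2 ≤ (‖T‖ * ‖f‖) ^ 2 := by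
  classical
  rcases isEmpty_or_nonempty (∀ i, κ i) with he | ⟨⟨y0⟩⟩
  · refine ⟨(hasSum_empty (f := fun y : (∀ i, κ i) => ‖siteFun i T f y‖ ^ 2)).summable, ?_⟩
    rw [tsum_empty]; positivity
  -- split coordinates, with the direction `i` as the inner sum
  let e : ((∀ j : {j // j ≠ i}, κ j) × κ i) ≃ (∀ i, κ i) :=
    (Equiv.prodComm _ _).trans (Equiv.piSplitAt i κ).symm
  let b : (∀ j : {j // j ≠ i}, κ j) → ∀ i, κ i := fun r => e (r, y0 i)
  have he : ∀ r a, e (r, a) = Function.update (b r) i a := by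
    intro r a
    have : (fun j : {j // j ≠ i} => b r j) = r := by
      have := (Equiv.piSplitAt i κ).apply_symm_apply (y0 i, r)
      exact congrArg Prod.snd this
    rw [← piSplitAt_symm_eq_update i (b r) a, this]
    rfl
  have hsl : ∀ r a, slice i f (e (r, a)) = slice i f (b r) := by
    intro r a
    ext c
    simp [slice_apply, he]
  have hf : HasSum (fun p : (∀ j : {j // j ≠ i}, κ j) × κ i => ‖f (e p)‖ ^ 2) (‖f‖ ^ 2) :=
    e.hasSum_iff.mpr (hasSum_sq _ f)
  have hrow : ∀ r, HasSum (fun a => ‖f (e (r, a))‖ ^ 2) (‖slice i f (b r)‖ ^ 2) := by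
    intro r
    have := hasSum_sq _ (slice i f (b r))
    simpa [slice_apply, he] using this
  have hout := hf.prod_fiberwise hrow
  have hTrow : ∀ r, HasSum (fun a => ‖siteFun i T f (e (r, a))‖ ^ 2)
      (‖T (slice i f (b r))‖ ^ 2) := by
    intro r
    have := hasSum_sq _ (T (slice i f (b r)))
    have h2 : ∀ a, siteFun i T f (e (r, a)) = T (slice i f (b r)) a := by
      intro a
      unfold siteFun
      rw [hsl, he]
      simp
    simpa [h2] using this
  have hle : ∀ r, ‖T (slice i f (b r))‖ ^ 2 ≤ ‖T‖ ^ 2 * ‖slice i f (b r)‖ ^ 2 := by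
    intro r
    rw [← mul_pow]
    gcongr
    exact T.le_opNorm _
  have hs2 : Summable (fun r => ‖T (slice i f (b r))‖ ^ 2) :=
    Summable.of_nonneg_of_le (fun r => by positivity) hle (hout.summable.mul_left _)
  have hsum : Summable (fun p : (∀ j : {j // j ≠ i}, κ j) × κ i =>
      ‖siteFun i T f (e p)‖ ^ 2) := by
    rw [summable_prod_of_nonneg (fun p => by positivity)]
    refine ⟨fun r => (hTrow r).summable, ?_⟩
    simpa only [(hTrow _).tsum_eq] using hs2
  refine ⟨e.summable_iff.mp hsum, ?_⟩
  rw [← e.tsum_eq, hsum.tsum_prod' (fun r => (hTrow r).summable)]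
  simp only [(hTrow _).tsum_eq]
  calc _ ≤ ∑' r, ‖T‖ ^ 2 * ‖slice i f (b r)‖ ^ 2 :=
        hs2.tsum_le_tsum hle (hout.summable.mul_left _)
    _ = (‖T‖ * ‖f‖) ^ 2 := by rw [tsum_mul_left, hout.tsum_eq, mul_pow]

/-- The operator `T` of party `i`, acting on the joint space (and as the identity on the other
parties). -/
def siteOp (i : V) (T : L2 (κ i) →L[ℂ] L2 (κ i)) : L2 (∀ i, κ i) →L[ℂ] L2 (∀ i, κ i) :=
  LinearMap.mkContinuous
    { toFun := fun f => ⟨siteFun i T f, memℓp_gen (by simpa using (siteFun_bound i T f).1)⟩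
      map_add' := by
        intro f g
        ext y
        have : slice i (f + g) y = slice i f y + slice i g y := by ext; rfl
        show siteFun i T (f + g) y = siteFun i T f y + siteFun i T g y
        simp [siteFun, this]
      map_smul' := by
        intro c f
        ext y
        have : slice i (c • f) y = c • slice i f y := by ext; rfl
        show siteFun i T (c • f) y = c • siteFun i T f y
        simp [siteFun, this] }
    ‖T‖ (by
      intro f
      refine le_of_sq_le_sq ?_ (by positivity)
      rw [← (hasSum_sq _ _).tsum_eq]
      exact (siteFun_bound i T f).2)

theorem siteOp_apply (i : V) (T : L2 (κ i) →L[ℂ] L2 (κ i)) (f : L2 (∀ i, κ i))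
    (y : ∀ i, κ i) : siteOp i T f y = T (slice i f y) (y i) := rfl

variable [Fintype V]

/-- There is exactly one bounded operator `⊗ᵢ Tᵢ` on the joint space that sends each product
vector `⊗ᵢ vᵢ` to `⊗ᵢ Tᵢ vᵢ`. -/
theorem existsUnique_tensorOp (T : ∀ i, L2 (κ i) →L[ℂ] L2 (κ i)) :
    ∃! L : L2 (∀ i, κ i) →L[ℂ] L2 (∀ i, κ i),
      ∀ (v : ∀ i, L2 (κ i)) (f : L2 (∀ i, κ i)), (∀ x, f x = ∏ i, v i (x i)) →
        ∀ y, L f y = ∏ i, T i (v i) (y i) := by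
  classical
  have key : ∀ s : Finset V, ∃ L : L2 (∀ i, κ i) →L[ℂ] L2 (∀ i, κ i),
      ∀ (v : ∀ i, L2 (κ i)) (f : L2 (∀ i, κ i)), (∀ x, f x = ∏ i, v i (x i)) →
        ∀ y, L f y = ∏ i, (if i ∈ s then T i (v i) else v i) (y i) := by
    intro s
    induction s using Finset.induction_on with
    | empty => exact ⟨ContinuousLinearMap.id ℂ _, fun v f hf y => by simpa using hf y⟩
    | insert i s hi ih =>
      obtain ⟨L, hL⟩ := ih
      refine ⟨(siteOp i (T i)).comp L, fun v f hf y => ?_⟩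
      rw [ContinuousLinearMap.comp_apply, siteOp_apply]
      have hs : slice i (L f) y =
          (∏ j ∈ Finset.univ.erase i, (if j ∈ s then T j (v j) else v j) (y j)) • v i := by
        ext a
        rw [slice_apply, hL v f hf, ← Finset.mul_prod_erase _ _ (Finset.mem_univ i)]
        simp only [hi, if_false, Function.update_self]
        rw [mul_comm, lp.coeFn_smul, Pi.smul_apply, smul_eq_mul]
        congr 1
        refine Finset.prod_congr rfl fun j hj => ?_
        rw [Function.update_of_ne (Finset.ne_of_mem_erase hj)]
      rw [hs, map_smul, ← Finset.mul_prod_erase _ _ (Finset.mem_univ i), mul_comm,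
        lp.coeFn_smul, Pi.smul_apply, smul_eq_mul]
      congr 1
      · refine Finset.prod_congr rfl fun j hj => ?_
        simp [Finset.mem_insert, Finset.ne_of_mem_erase hj]
      · simp
  obtain ⟨L, hL⟩ := key Finset.univ
  refine ⟨L, fun v f hf y => by simpa using hL v f hf y, fun L' hL' => ?_⟩
  ext1 f
  have hfs := lp.hasSum_single (p := 2) (by norm_num) f
  have hsing : ∀ x (c : ℂ), L' (lp.single 2 x c) = L (lp.single 2 x c) := by
    intro x c
    have h1 : ∀ z, (lp.single 2 x (1 : ℂ) : L2 (∀ i, κ i)) z =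
        ∏ i, (lp.single 2 (x i) (1 : ℂ) : L2 (κ i)) (z i) := by
      intro z
      by_cases hz : z = x
      · subst hz; simp
      · obtain ⟨i, hi⟩ := Function.ne_iff.mp hz
        rw [lp.single_apply_ne _ _ _ hz]
        exact (Finset.prod_eq_zero (Finset.mem_univ i) (lp.single_apply_ne _ _ _ hi)).symm
    have h2 : (lp.single 2 x c : L2 (∀ i, κ i)) = c • lp.single 2 x (1 : ℂ) := by
      rw [← lp.single_smul]; simp
    rw [h2, map_smul, map_smul]
    congr 1
    ext y
    rw [hL' _ _ h1 y, hL _ _ h1 y]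
    simp
  have a1 := hfs.mapL L'
  have a2 := hfs.mapL L
  simp only [hsing] at a1
  exact a1.unique a2

/-- The tensor product `⊗ᵢ Tᵢ` of local operators, acting on the joint Hilbert space
`⊗ᵢ ℓ²(κ i) = ℓ²(∏ i, κ i)`. -/
def tensorOp (T : ∀ i, L2 (κ i) →L[ℂ] L2 (κ i)) : L2 (∀ i, κ i) →L[ℂ] L2 (∀ i, κ i) :=
  (existsUnique_tensorOp T).choose

theorem tensorOp_apply (T : ∀ i, L2 (κ i) →L[ℂ] L2 (κ i)) (v : ∀ i, L2 (κ i))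
    (f : L2 (∀ i, κ i)) (hf : ∀ x, f x = ∏ i, v i (x i)) (y : ∀ i, κ i) :
    tensorOp T f y = ∏ i, T i (v i) (y i) :=
  (existsUnique_tensorOp T).choose_spec.1 v f hf y

end TensorProduct

/-! ## Correlators and Bell expressions

Each party `i` has two binary observables `A i` and `B i`. A correlator is indexed by a map
`m : V → SignType`: party `i` measures `A i` if `m i = 1`, `B i` if `m i = -1`, and does not
measure if `m i = 0`. -/

/-- The entry of a triple that a setting selects: `o` for `0`, `a` for `1`, `b` for `-1`. -/
def pick {α : Type} (o a b : α) : SignType → α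
  | SignType.zero => o
  | SignType.pos => a
  | SignType.neg => b

/-- A Bell expression `∑ m, β m ⟨∏ i, O i (m i)⟩`, given by its real coefficients. -/
abbrev BellExpr (V : Type) : Type := (V → SignType) → ℝ

/-- The number of correlators that occur in a Bell expression. -/
def BellExpr.numCorrelators {V : Type} (β : BellExpr V) : ℕ := Set.ncard {m | β m ≠ 0}

section Values

variable {V : Type} [Fintype V] [DecidableEq V]

/-- The values that local hidden variable models give to a Bell expression. The hidden variable
is a deterministic strategy, which fixes the outcomes `±1` of both observables of each party. -/
def classicalValues (β : BellExpr V) : Set ℝ :=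
  {v | ∃ p ∈ stdSimplex ℝ (V → ℤˣ × ℤˣ),
    v = ∑ l, p l * ∑ m, β m * ∏ i, pick 1 (((l i).1 : ℤ) : ℝ) (((l i).2 : ℤ) : ℝ) (m i)}

/-- A quantum realization: local Hilbert spaces `ℓ²(κ i)` of arbitrary dimension, two observables
with spectrum in `{1, -1}` for each party, and a density operator `ρ = ∑ e, |ψ e⟩⟨ψ e|` of trace
one on the joint space (a pure state is the case where `E` has one element). -/
structure Realization (V : Type) [Fintype V] where
  κ : V → Type
  E : Type
  ψ : E → L2 (∀ i, κ i)
  norm_ψ : HasSum (fun e => ‖ψ e‖ ^ 2) 1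
  A : ∀ i, L2 (κ i) →L[ℂ] L2 (κ i)
  B : ∀ i, L2 (κ i) →L[ℂ] L2 (κ i)
  A_selfAdjoint : ∀ i, IsSelfAdjoint (A i)
  B_selfAdjoint : ∀ i, IsSelfAdjoint (B i)
  A_sq : ∀ i, A i * A i = 1
  B_sq : ∀ i, B i * B i = 1

/-- The operator `⊗ᵢ Oᵢ(mᵢ)` measured by the correlator `m`. -/
def Realization.obs (Q : Realization V) (m : V → SignType) :
    L2 (∀ i, Q.κ i) →L[ℂ] L2 (∀ i, Q.κ i) :=
  tensorOp fun i => pick 1 (Q.A i) (Q.B i) (m i)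

/-- The value `∑ m, β m tr(ρ ⊗ᵢ Oᵢ(mᵢ))` of a Bell expression. -/
def Realization.value (Q : Realization V) (β : BellExpr V) : ℝ :=
  ∑ m, β m * ∑' e, (inner ℂ (Q.ψ e) (Q.obs m (Q.ψ e))).re

/-- The values that quantum realizations give to a Bell expression. -/
def quantumValues (β : BellExpr V) : Set ℝ := Set.range fun Q : Realization V => Q.value β

end Values

/-! ## Graph states and their stabilizers -/

section GraphState

variable {V : Type} [Fintype V] [DecidableEq V]

open scoped Classical in
/-- The amplitudes of the graph state `∏_{ {i,j} ∈ E } CZ^{ {i,j} } |+⟩^{⊗ N}` in the computational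
basis: each `CZ` contributes a sign `-1` where both of its qubits are `1`. -/
def graphState (G : SimpleGraph V) (x : V → Fin 2) : ℂ :=
  (∏ e ∈ G.edgeFinset, if ∀ i ∈ e, x i = 1 then -1 else 1) * ∏ _i : V, ((1 / √2 : ℝ) : ℂ)

open scoped Classical in
/-- For a set `D` of pairwise non-adjacent vertices, the stabilizer `∏_{i ∈ D} G_i`, where
`G_i = X_i ⊗_{j ∈ n_i} Z_j`, is a tensor product of operators `X`, `Z`, `I`. It is encoded by a
sign sequence: `1` for `X` (on `D`), `-1` for `Z` (off `D`, where an odd number of the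
generators contribute a `Z`), `0` for `I`. -/
def stabSeq (G : SimpleGraph V) (D : Finset V) (i : V) : SignType :=
  if i ∈ D then 1 else if Odd (D.filter (G.Adj i)).card then -1 else 0

def pauliX : Matrix (Fin 2) (Fin 2) ℂ := !![0, 1; 1, 0]

def pauliZ : Matrix (Fin 2) (Fin 2) ℂ := !![1, 0; 0, -1]

/-! ## Bell inequalities from pairable stabilizers -/

/-- The data for a Bell inequality from stabilizers, each of them a product of generators inside
one colour class of a proper colouring `c`. A stabilizer is given by its set of generators. `P` is
the set of chosen pairs of stabilizers, `R` the set of the remaining ones and `AC` the set of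
positions with rotated observables. Each unordered pair in `P` is listed with the stabilizer
first that has `X` at the position where the two anticommute. -/
structure Construction (G : SimpleGraph V) {K : ℕ} (c : G.Coloring (Fin K)) where
  P : Finset (Finset V × Finset V)
  R : Finset (Finset V)
  AC : Finset V
  /-- Every stabilizer is a nonempty product of generators of one colour class. -/
  mono_fst : ∀ p ∈ P, p.1.Nonempty ∧ ∃ k, ∀ i ∈ p.1, c i = k
  mono_snd : ∀ p ∈ P, p.2.Nonempty ∧ ∃ k, ∀ i ∈ p.2, c i = k
  mono_R : ∀ D ∈ R, D.Nonempty ∧ ∃ k, ∀ i ∈ D, c i = k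
  /-- A pair anticommutes at one position of `AC` and is trivial at the others. -/
  pair : ∀ p ∈ P, ∃ T ∈ AC, stabSeq G p.1 T = 1 ∧ stabSeq G p.2 T = -1 ∧
    ∀ i ∈ AC, i ≠ T → stabSeq G p.1 i = 0 ∧ stabSeq G p.2 i = 0
  /-- The other stabilizers are trivial on `AC`. -/
  rest : ∀ D ∈ R, ∀ i ∈ AC, stabSeq G D i = 0

open scoped Classical in
/-- The coefficient of the correlator `m` in the expansion of the term of a stabilizer with
sequence `s`: a position `i ∈ AC` with `s i ≠ 0` contributes the factor `A i + s i B i`, every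
other position contributes `I`, `A i`, `B i` for `s i = 0, 1, -1`. -/
def termCoeff (AC : Finset V) (s m : V → SignType) : ℝ :=
  ∏ i, if i ∈ AC ∧ s i ≠ 0 then pick 0 1 (s i : ℝ) (m i) else if m i = s i then 1 else 0

/-- The Bell expression of the construction: the sum of the terms of both members of each pair in
`P` and of the terms of the members of `R`. -/
def Construction.bell {G : SimpleGraph V} {K : ℕ} {c : G.Coloring (Fin K)}
    (C : Construction G c) : BellExpr V := fun m =>
  ∑ p ∈ C.P, (termCoeff C.AC (stabSeq G p.1) m + termCoeff C.AC (stabSeq G p.2) m) +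
    ∑ D ∈ C.R, termCoeff C.AC (stabSeq G D) m

/-! ## Self-testing -/

open scoped Classical in
/-- The reference observable of party `i` for a setting: `(X + Z) / √2` and `(X - Z) / √2` for
`A i` and `B i` if `i ∈ AC`, and `X` and `Z` otherwise. -/
def refObs (AC : Finset V) (i : V) : SignType → Matrix (Fin 2) (Fin 2) ℂ :=
  if i ∈ AC then
    pick 1 (((1 / √2 : ℝ) : ℂ) • (pauliX + pauliZ)) (((1 / √2 : ℝ) : ℂ) • (pauliX - pauliZ))
  else pick 1 pauliX pauliZ

/-- The vector `(⊗ᵢ Pᵢ(mᵢ)) |ψ_G⟩`, the reference observables applied to the graph state. -/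
def refVector (G : SimpleGraph V) (AC : Finset V) (m : V → SignType) (a : V → Fin 2) : ℂ :=
  ∑ b : V → Fin 2, (∏ i, refObs AC i (m i) (a i) (b i)) * graphState G b

/-- Self-testing: in every realization that attains the maximal quantum value, local isometries
`Φᵢ : H_i → ℂ² ⊗ H_i`, `v ↦ |0⟩ ⊗ W i 0 v + |1⟩ ⊗ W i 1 v`, take the state and the observables to
the graph state and the reference observables, tensored with some extra state: for every choice
`m` of settings, `(⊗ᵢ Φᵢ) (⊗ᵢ Oᵢ(mᵢ)) |ψ⟩ = (⊗ᵢ Pᵢ(mᵢ)) |ψ_G⟩ ⊗ |extra⟩`. The equation is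
written for the components along the computational basis vectors `|a⟩` of the `N` qubits. -/
def SelfTests (β : BellExpr V) (G : SimpleGraph V) (AC : Finset V) : Prop :=
  ∀ Q : Realization V, IsGreatest (quantumValues β) (Q.value β) →
    ∃ (W : ∀ i, Fin 2 → L2 (Q.κ i) →L[ℂ] L2 (Q.κ i)) (extra : Q.E → L2 (∀ i, Q.κ i)),
      (∀ i v, ‖W i 0 v‖ ^ 2 + ‖W i 1 v‖ ^ 2 = ‖v‖ ^ 2) ∧
      HasSum (fun e => ‖extra e‖ ^ 2) 1 ∧
      ∀ m e a, tensorOp (fun i => W i (a i)) (Q.obs m (Q.ψ e)) =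
        refVector G AC m a • extra e

end GraphState

end StabBell

end

/-!
# Optimal Bell inequalities from stabilizers of graph states

For a deterministic strategy one of `A + B` and `A - B` vanishes, so a pair of stabilizers
contributes at most `2`, and each other stabilizer at most `1`. The strategy with all outcomes `1`
reaches all these bounds, so the classical maximum is `2 |P| + |R|`. For a quantum realization, let
`X` and `Z` be `(A + B) / √2` and `(A - B) / √2` at the position where a pair anticommutes, and `L`,
`M` the products of the observables of the other parties in the two stabilizers. Then
`2 √2 ‖ψ‖² - Re ⟨ψ, ((A + B) L + (A - B) M) ψ⟩ = (‖X ψ - L ψ‖² + ‖Z ψ - M ψ‖²) / √2`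
(`Realization.pair_deficit`), so the quantum value is at most `2 √2 |P| + |R|`. This bounds the ratio
by `√2`, and suggests to use no stabilizers in `R`.

In a colouring with the minimal number of colours some vertex `T` has a neighbour in every colour but
its own (`exists_hub`). Take `AC = {T}`. Each vertex `i` gets the stabilizer `G_i` if this is
nontrivial at `T`, and otherwise `G_i G_j` with `j` a vertex of the same colour for which `G_j` is
nontrivial at `T`. Those of the colour of `T` have `X` at `T`, the others have `Z` there, and all
pairs of one with the other are used. Each of the `N` terms has two correlators, and no correlator
occurs in two terms. The graph state with the reference observables attains the quantum bound.

If a realization attains it, all the squares vanish. Hence `X² ψ = Z² ψ = ψ` at `T`, and all the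
chosen stabilizers fix `ψ`; so do their products, the generators `G_i`
(`Hub.stabilizes_iff`). At `T` the operators `X` and `Z` anticommute identically. The two generators
of an edge carry anticommutation on `ψ` from one end to the other (`anticomm_of_adj`), and by
connectedness it holds at every vertex. The local isometries that swap a qubit with the pair of
observables then turn `ψ` into a family of vectors indexed by bit strings with the stabilizer
symmetries of the graph state, which determine it up to a common factor (`eq_graphState_smul`).
At `T` the operators `X` and `Z` need not be unitary, so the isometry there is built
from `A` and `B`, which also anticommute on `ψ`, and followed by a rotation of the qubit
(`exists_isometry_rotated`).
-/

noncomputable section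

namespace StabBell

set_option linter.unusedSectionVars false

/-! ### The algebra of tensor products of operators -/

section Tensor

variable {V : Type} [Fintype V] [dV : DecidableEq V] {κ : V → Type}

theorem eq_tensorOp {T : ∀ i, L2 (κ i) →L[ℂ] L2 (κ i)} {L : L2 (∀ i, κ i) →L[ℂ] L2 (∀ i, κ i)}
    (h : ∀ (v : ∀ i, L2 (κ i)) (f : L2 (∀ i, κ i)), (∀ x, f x = ∏ i, v i (x i)) →
        ∀ y, L f y = ∏ i, T i (v i) (y i)) : L = tensorOp T :=
  (existsUnique_tensorOp T).unique h (tensorOp_apply T)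

theorem tensorOp_one : tensorOp (1 : ∀ i, L2 (κ i) →L[ℂ] L2 (κ i)) = 1 :=
  (eq_tensorOp fun v f hf y => by simpa using hf y).symm

theorem tensorOp_mul (S T : ∀ i, L2 (κ i) →L[ℂ] L2 (κ i)) :
    tensorOp (S * T) = tensorOp S * tensorOp T :=
  (eq_tensorOp fun v f hf y => by
    rw [mul_apply_eq_comp]
    exact tensorOp_apply S (fun i => T i (v i)) _ (tensorOp_apply T v f hf) y).symm

/-- `tensorOp` as a multilinear map in the local operators. -/
def tensorMulti (κ : V → Type) : MultilinearMap ℂ (fun i => L2 (κ i) →L[ℂ] L2 (κ i))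
    (L2 (∀ i, κ i) →L[ℂ] L2 (∀ i, κ i)) where
  toFun := tensorOp
  map_update_add' := by
    intro inst T i A B
    obtain rfl : inst = dV := Subsingleton.elim _ _
    refine (eq_tensorOp fun v f hf y => ?_).symm
    rw [add_apply, lp.coeFn_add, Pi.add_apply, tensorOp_apply _ v f hf,
      tensorOp_apply _ v f hf]
    simp only [← Finset.mul_prod_erase _ _ (Finset.mem_univ i), Function.update_self,
      add_apply, lp.coeFn_add, Pi.add_apply]
    rw [add_mul]
    congr 2 <;> refine Finset.prod_congr rfl fun j hj => ?_ <;>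
      rw [Function.update_of_ne (Finset.ne_of_mem_erase hj),
        Function.update_of_ne (Finset.ne_of_mem_erase hj)]
  map_update_smul' := by
    intro inst T i c A
    obtain rfl : inst = dV := Subsingleton.elim _ _
    refine (eq_tensorOp fun v f hf y => ?_).symm
    rw [smul_apply, lp.coeFn_smul, Pi.smul_apply, tensorOp_apply _ v f hf]
    simp only [← Finset.mul_prod_erase _ _ (Finset.mem_univ i), Function.update_self,
      smul_apply, lp.coeFn_smul, Pi.smul_apply, smul_eq_mul]
    rw [mul_assoc]
    congr 2
    refine Finset.prod_congr rfl fun j hj => ?_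
    rw [Function.update_of_ne (Finset.ne_of_mem_erase hj),
      Function.update_of_ne (Finset.ne_of_mem_erase hj)]

theorem tensorMulti_apply (T : ∀ i, L2 (κ i) →L[ℂ] L2 (κ i)) :
    tensorMulti κ T = tensorOp T := rfl

/-- Expansion of a tensor product of linear combinations of operators. -/
theorem tensorOp_sum_smul {ι : Type} [Fintype ι] (f : V → ι → ℂ)
    (O : ∀ i, ι → L2 (κ i) →L[ℂ] L2 (κ i)) :
    tensorOp (fun i => ∑ σ, f i σ • O i σ) =
      ∑ m : V → ι, (∏ i, f i (m i)) • tensorOp (fun i => O i (m i)) := by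
  classical
  rw [← tensorMulti_apply, MultilinearMap.map_sum]
  refine Finset.sum_congr rfl fun m _ => ?_
  exact (tensorMulti κ).map_smul_univ (fun i => f i (m i)) (fun i => O i (m i))

theorem tensorOp_smul (f : V → ℂ) (O : ∀ i, L2 (κ i) →L[ℂ] L2 (κ i)) :
    tensorOp (fun i => f i • O i) = (∏ i, f i) • tensorOp O :=
  (tensorMulti κ).map_smul_univ f O

theorem clm_ext_single {α : Type} [DecidableEq α] {F : Type} [NormedAddCommGroup F]
    [NormedSpace ℂ F] {S T : L2 α →L[ℂ] F}
    (h : ∀ x, S (lp.single 2 x (1 : ℂ)) = T (lp.single 2 x (1 : ℂ))) : S = T := by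
  ext1 f
  have hfs := lp.hasSum_single (p := 2) (by norm_num) f
  have hc : ∀ x (c : ℂ), (lp.single 2 x c : L2 α) = c • lp.single 2 x (1 : ℂ) := by
    intro x c
    rw [← lp.single_smul]; simp
  have a1 := hfs.mapL S
  have a2 := hfs.mapL T
  simp only [hc _ (f _), map_smul, h] at a1 a2
  exact a1.unique a2

/-- The matrix entries of a tensor product of operators are products of matrix entries. -/
theorem tensorOp_single [∀ i, DecidableEq (κ i)] [DecidableEq (∀ i, κ i)]
    (T : ∀ i, L2 (κ i) →L[ℂ] L2 (κ i)) (x y : ∀ i, κ i) :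
    tensorOp T (lp.single 2 x (1 : ℂ)) y = ∏ i, T i (lp.single 2 (x i) (1 : ℂ)) (y i) := by
  refine tensorOp_apply T (fun i => lp.single 2 (x i) (1 : ℂ)) _ (fun z => ?_) y
  by_cases hz : z = x
  · subst hz; simp
  · obtain ⟨i, hi⟩ := Function.ne_iff.mp hz
    rw [lp.single_apply_ne _ _ _ hz]
    exact (Finset.prod_eq_zero (Finset.mem_univ i) (lp.single_apply_ne _ _ _ hi)).symm

theorem inner_single_one {α : Type} [DecidableEq α] (x : α) (f : L2 α) :
    inner ℂ (lp.single 2 x (1 : ℂ)) f = f x := by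
  rw [lp.inner_single_left]; simp

theorem star_apply_single {α : Type} [DecidableEq α] (T : L2 α →L[ℂ] L2 α) (x y : α) :
    (star T) (lp.single 2 x (1 : ℂ)) y = (starRingEnd ℂ) (T (lp.single 2 y (1 : ℂ)) x) := by
  rw [← inner_single_one y, ContinuousLinearMap.star_eq_adjoint,
    ContinuousLinearMap.adjoint_inner_right, ← inner_conj_symm, inner_single_one]

theorem star_tensorOp (T : ∀ i, L2 (κ i) →L[ℂ] L2 (κ i)) :
    star (tensorOp T) = tensorOp (star T) := by
  classical
  refine clm_ext_single fun x => ?_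
  ext y
  rw [star_apply_single, tensorOp_single, tensorOp_single, map_prod]
  exact Finset.prod_congr rfl fun i _ => (star_apply_single _ _ _).symm

/-- The operator `T` of party `i` acting on the joint space, as an algebra homomorphism in `T`. -/
def localOp (i : V) : (L2 (κ i) →L[ℂ] L2 (κ i)) →ₐ[ℂ] (L2 (∀ i, κ i) →L[ℂ] L2 (∀ i, κ i)) :=
  AlgHom.ofLinearMap ((tensorMulti κ).toLinearMap 1 i)
    (by
      show tensorOp (Pi.mulSingle i 1) = 1
      rw [Pi.mulSingle_one, tensorOp_one])
    (by
      intro S T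
      show tensorOp (Pi.mulSingle i (S * T)) =
        tensorOp (Pi.mulSingle i S) * tensorOp (Pi.mulSingle i T)
      rw [Pi.mulSingle_mul, tensorOp_mul])

theorem localOp_apply (i : V) (T : L2 (κ i) →L[ℂ] L2 (κ i)) :
    localOp i T = tensorOp (Pi.mulSingle i T) := rfl

theorem star_localOp (i : V) (T : L2 (κ i) →L[ℂ] L2 (κ i)) :
    star (localOp i T) = localOp i (star T) := by
  rw [localOp_apply, localOp_apply, star_tensorOp]
  congr 1
  ext1 j
  rcases eq_or_ne j i with rfl | h
  · simp
  · simp [Pi.mulSingle_eq_of_ne h]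

theorem tensorOp_eq_mul_localOp (T : ∀ i, L2 (κ i) →L[ℂ] L2 (κ i)) (i : V) :
    tensorOp T = tensorOp (Function.update T i 1) * localOp i (T i) := by
  rw [localOp_apply, ← tensorOp_mul]
  congr 1
  ext1 j
  rcases eq_or_ne j i with rfl | h
  · simp
  · simp [h]

/-- A tensor product that is trivial at `i` commutes with the operators of party `i`. -/
theorem tensorOp_mul_localOp_comm (T : ∀ i, L2 (κ i) →L[ℂ] L2 (κ i)) (i : V) (hT : T i = 1)
    (S : L2 (κ i) →L[ℂ] L2 (κ i)) : tensorOp T * localOp i S = localOp i S * tensorOp T := by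
  rw [localOp_apply, ← tensorOp_mul, ← tensorOp_mul]
  congr 1
  ext1 j
  rcases eq_or_ne j i with rfl | h
  · simp [hT]
  · simp [h]

/-- Local operators that act alike on a vector, party by party, have tensor products that act
alike on it. -/
theorem tensorOp_apply_congr {S T : ∀ i, L2 (κ i) →L[ℂ] L2 (κ i)} {ψ : L2 (∀ i, κ i)}
    (h : ∀ i, localOp i (S i) ψ = localOp i (T i) ψ) : tensorOp S ψ = tensorOp T ψ := by
  -- Replace the local operators one party at a time.
  have key : ∀ s : Finset V, tensorOp (s.piecewise S T) ψ = tensorOp T ψ := by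
    intro s
    induction s using Finset.induction_on with
    | empty => simp
    | insert i s hi ih =>
      rw [← ih, tensorOp_eq_mul_localOp _ i, tensorOp_eq_mul_localOp (s.piecewise S T) i,
        Finset.piecewise_insert]
      simp [hi, h]
  simpa using key Finset.univ

/-- If `Wᵢ(0)` and `Wᵢ(1)` are the components of an isometry for each `i`, then the components
of the tensor product of these isometries have the squared norms of an isometry. -/
theorem sum_norm_tensorOp_sq (W : ∀ i, Fin 2 → L2 (κ i) →L[ℂ] L2 (κ i))
    (hW : ∀ i, ∑ a, star (W i a) * W i a = 1) (ψ : L2 (∀ i, κ i)) :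
    ∑ a : V → Fin 2, ‖tensorOp (fun i => W i (a i)) ψ‖ ^ 2 = ‖ψ‖ ^ 2 := by
  have h1 := tensorOp_sum_smul (fun _ _ => 1) fun i a => star (W i a) * W i a
  simp only [one_smul, hW, Finset.prod_const_one] at h1
  have h2 : (tensorOp fun i => 1 : L2 (∀ i, κ i) →L[ℂ] L2 (∀ i, κ i)) = 1 := tensorOp_one
  rw [h2] at h1
  have h3 := congrArg (fun L : L2 (∀ i, κ i) →L[ℂ] L2 (∀ i, κ i) => (inner ℂ ψ (L ψ)).re) h1
  simp only [one_apply_eq_self, sum_apply, inner_sum,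
    Complex.re_sum] at h3
  have h4 : (inner ℂ ψ ψ).re = ‖ψ‖ ^ 2 := inner_self_eq_norm_sq (𝕜 := ℂ) ψ
  rw [← h4, h3]
  refine Finset.sum_congr rfl fun a _ => ?_
  have : (tensorOp fun i => star (W i (a i)) * W i (a i)) =
      star (tensorOp fun i => W i (a i)) * tensorOp fun i => W i (a i) := by
    rw [star_tensorOp, ← tensorOp_mul]; rfl
  rw [this, mul_apply_eq_comp, ContinuousLinearMap.star_eq_adjoint,
    ContinuousLinearMap.adjoint_inner_right]
  exact (inner_self_eq_norm_sq (𝕜 := ℂ) _).symm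

end Tensor

/-! ### Hubs of minimal colourings -/

section Combinatorics

variable {V : Type} [Fintype V] [DecidableEq V] {G : SimpleGraph V}

/-- A vertex with a neighbour in every colour other than its own. The vertex `rep k` is the
chosen neighbour of colour `k`; for the colour of the hub it is the hub itself. -/
structure Hub (G : SimpleGraph V) {K : ℕ} (c : G.Coloring (Fin K)) where
  T : V
  rep : Fin K → V
  rep_self : rep (c T) = T
  adj_rep : ∀ k, k ≠ c T → G.Adj T (rep k)
  colour_rep_of_ne : ∀ k, k ≠ c T → c (rep k) = k

/-- A colouring with the minimal number of colours has a hub: otherwise every vertex of some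
colour could be moved to a colour that none of its neighbours has. -/
theorem exists_hub [Nonempty V] {K : ℕ} (hK : G.chromaticNumber = (K : ℕ∞))
    (c : G.Coloring (Fin K)) : Nonempty (Hub G c) := by
  classical
  obtain ⟨v₀⟩ := ‹Nonempty V›
  by_cases h : ∃ T, c T = c v₀ ∧ ∀ k, k ≠ c v₀ → ∃ j, G.Adj T j ∧ c j = k
  · obtain ⟨T, hT, h⟩ := h
    choose! f hf using h
    refine ⟨⟨T, fun k => if k = c T then T else f k, by simp, fun k hk => ?_, fun k hk => ?_⟩⟩
    · simpa [hk] using (hf k (hT ▸ hk)).1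
    · simpa [hk] using (hf k (hT ▸ hk)).2
  -- Every vertex `v` with the colour of `v₀` can move to a colour `g v`, which frees one colour.
  · push Not at h
    choose g hg1 hg2 using h
    let c' : G.Coloring {k // k ≠ c v₀} := SimpleGraph.Coloring.mk
      (fun v => if hv : c v = c v₀ then ⟨g v hv, hg1 v hv⟩ else ⟨c v, hv⟩) (by
        intro v w hvw
        have hne := c.valid hvw
        by_cases hv : c v = c v₀ <;> by_cases hw : c w = c v₀
        · exact absurd (hv.trans hw.symm) hne
        · simpa [hv, hw] using (hg2 v hv w hvw).symm
        · simpa [hv, hw] using hg2 w hw v hvw.symm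
        · simpa [hv, hw] using hne)
    have h1 := c'.colorable
    have h2 : Fintype.card {k // k ≠ c v₀} = K - 1 := by
      simp [Fintype.card_subtype_compl]
    rw [h2] at h1
    have h3 := h1.chromaticNumber_le
    rw [hK] at h3
    have h4 : K ≤ K - 1 := by exact_mod_cast h3
    have := (c v₀).pos
    omega

namespace Hub

variable {K : ℕ} {c : G.Coloring (Fin K)} (h : Hub G c)

theorem colour_rep (k : Fin K) : c (h.rep k) = k := by
  by_cases hk : k = c h.T
  · subst hk; rw [h.rep_self]
  · exact h.colour_rep_of_ne k hk

open scoped Classical in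
/-- The generators of the stabilizer attached to the vertex `i`. It is `G_i` if this acts
nontrivially on the hub; otherwise `G_i` is multiplied by the generator of the representative of
its colour, which does. -/
def gens (i : V) : Finset V :=
  if i = h.T ∨ G.Adj h.T i then {i} else {i, h.rep (c i)}

theorem mem_gens (i : V) : i ∈ h.gens i := by
  unfold gens; split_ifs <;> simp

theorem gens_nonempty (i : V) : (h.gens i).Nonempty := ⟨i, h.mem_gens i⟩

theorem colour_of_mem_gens {i j : V} (hj : j ∈ h.gens i) : c j = c i := by
  unfold gens at hj
  split_ifs at hj
  · rw [Finset.mem_singleton.mp hj]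
  · rcases Finset.mem_insert.mp hj with rfl | hj
    · rfl
    · rw [Finset.mem_singleton.mp hj, colour_rep]

theorem stabSeq_gens_of_eq {i : V} (hi : c i = c h.T) : stabSeq G (h.gens i) h.T = 1 := by
  have : h.T ∈ h.gens i := by
    unfold gens
    split_ifs with h1
    · rcases h1 with rfl | h1
      · simp
      · exact absurd hi.symm (c.valid h1)
    · simp [hi, h.rep_self]
  simp [stabSeq, this]

theorem stabSeq_gens_of_ne {i : V} (hi : c i ≠ c h.T) : stabSeq G (h.gens i) h.T = -1 := by
  classical
  have h1 : h.T ∉ h.gens i := fun h2 => hi (h.colour_of_mem_gens h2).symm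
  have hT : i ≠ h.T := by rintro rfl; exact hi rfl
  have h2 : ((h.gens i).filter (G.Adj h.T)).card = 1 := by
    unfold gens
    split_ifs with h1
    · have : G.Adj h.T i := h1.resolve_left hT
      simp [Finset.filter_singleton, this]
    · rw [not_or] at h1
      simp [Finset.filter_insert, Finset.filter_singleton, h1.2, h.adj_rep _ hi]
  have h3 : ((h.gens i).filter (fun j => G.Adj h.T j)).card = 1 := h2
  simp only [stabSeq, h1, if_false]
  rw [if_pos]
  convert odd_one

/-- The stabilizers attached to different vertices differ at a position other than the hub. -/
theorem eq_of_stabSeq_gens {i j : V}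
    (hij : ∀ k, k ≠ h.T → stabSeq G (h.gens i) k = stabSeq G (h.gens j) k) : i = j := by
  classical
  have hmem : ∀ k, k ≠ h.T → (k ∈ h.gens i ↔ k ∈ h.gens j) := by
    have : ∀ (D : Finset V) k, k ∈ D ↔ stabSeq G D k = 1 := by
      intro D k
      unfold stabSeq
      split_ifs <;> simp_all
    intro k hk
    rw [this, this, hij k hk]
  by_contra hne
  -- The set attached to `j` contains another vertex `i` besides the hub only if `i` is the
  -- representative, a neighbour of the hub, and `j` is not such a neighbour.
  have hadj : ∀ i j : V, i ≠ j → i ∈ h.gens j → i ≠ h.T → G.Adj h.T i ∧ ¬ G.Adj h.T j := by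
    intro i j hne hi hiT
    unfold gens at hi
    split_ifs at hi with h1
    · exact absurd (Finset.mem_singleton.mp hi) hne
    · have hi' : i = h.rep (c j) := by simpa [hne] using hi
      rw [not_or] at h1
      refine ⟨?_, h1.2⟩
      rw [hi']
      refine h.adj_rep _ fun hc => hiT ?_
      rw [hi', hc, h.rep_self]
  have hTT : ∀ j, j ∈ h.gens h.T → j = h.T := by
    intro j hj
    simpa [gens] using hj
  by_cases hi : i = h.T
  · subst hi
    have hj : j ≠ h.T := fun h1 => hne h1.symm
    exact hj (hTT j ((hmem j hj).mpr (h.mem_gens j)))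
  · by_cases hj : j = h.T
    · subst hj
      exact hi (hTT i ((hmem i hi).mp (h.mem_gens i)))
    · exact (hadj j i (Ne.symm hne) ((hmem j hj).mpr (h.mem_gens j)) hj).2
        (hadj i j hne ((hmem i hi).mp (h.mem_gens i)) hi).1

theorem gens_injective : Function.Injective h.gens :=
  fun _ _ hij => h.eq_of_stabSeq_gens fun _ _ => by rw [hij]

/-- The vertices with the colour of the hub. -/
def sameColour : Finset V := Finset.univ.filter fun i => c i = c h.T

/-- The vertices with a colour other than that of the hub. -/
def otherColour : Finset V := Finset.univ.filter fun i => c i ≠ c h.T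

/-- The Bell inequality of a hub: the stabilizers attached to the vertices, which have `X` at the
hub for one colour and `Z` for the others, are paired in all possible ways. -/
def construction : Construction G c where
  P := h.sameColour.image h.gens ×ˢ h.otherColour.image h.gens
  R := ∅
  AC := {h.T}
  mono_fst := by
    intro p hp
    obtain ⟨i, -, hi⟩ := Finset.mem_image.mp (Finset.mem_product.mp hp).1
    rw [← hi]
    exact ⟨h.gens_nonempty i, c i, fun j => h.colour_of_mem_gens⟩
  mono_snd := by
    intro p hp
    obtain ⟨i, -, hi⟩ := Finset.mem_image.mp (Finset.mem_product.mp hp).2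
    rw [← hi]
    exact ⟨h.gens_nonempty i, c i, fun j => h.colour_of_mem_gens⟩
  mono_R := by simp
  pair := by
    intro p hp
    obtain ⟨i, hi, hi'⟩ := Finset.mem_image.mp (Finset.mem_product.mp hp).1
    obtain ⟨j, hj, hj'⟩ := Finset.mem_image.mp (Finset.mem_product.mp hp).2
    refine ⟨h.T, by simp, ?_, ?_, by simp +contextual⟩
    · rw [← hi', h.stabSeq_gens_of_eq (Finset.mem_filter.mp hi).2]
    · rw [← hj', h.stabSeq_gens_of_ne (Finset.mem_filter.mp hj).2]
  rest := by simp

theorem card_P : h.construction.P.card = h.sameColour.card * h.otherColour.card := by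
  simp [construction, Finset.card_product, Finset.card_image_of_injective _ h.gens_injective]

theorem sameColour_nonempty : h.sameColour.Nonempty := ⟨h.T, by simp [sameColour]⟩

theorem otherColour_nonempty [Nontrivial V] (hG : G.Connected) : h.otherColour.Nonempty := by
  obtain ⟨j, hj⟩ := hG.preconnected.exists_adj_of_nontrivial h.T
  exact ⟨j, by simpa [otherColour] using (c.valid hj).symm⟩

theorem bell_eq (m : V → SignType) : h.construction.bell m =
    ∑ i, ((if c i = c h.T then h.otherColour.card else h.sameColour.card : ℕ) : ℝ) *
      termCoeff {h.T} (stabSeq G (h.gens i)) m := by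
  have h1 : ∀ f : Finset V → ℝ, ∑ p ∈ h.sameColour.image h.gens ×ˢ h.otherColour.image h.gens,
      (f p.1 + f p.2) = ∑ i, ((if c i = c h.T then h.otherColour.card else h.sameColour.card : ℕ) : ℝ) *
        f (h.gens i) := by
    intro f
    simp only [Finset.sum_add_distrib, Finset.sum_product, Finset.sum_const,
      Finset.sum_image fun _ _ _ _ hij => h.gens_injective hij, nsmul_eq_mul]
    rw [← Finset.sum_filter_add_sum_filter_not Finset.univ (fun i => c i = c h.T), ← Finset.mul_sum]
    congr 1
    · rw [Finset.mul_sum]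
      exact Finset.sum_congr rfl fun i hi => by rw [if_pos (Finset.mem_filter.mp hi).2]
    · rw [Finset.mul_sum]
      exact Finset.sum_congr rfl fun i hi => by rw [if_neg (Finset.mem_filter.mp hi).2]
  simp only [Construction.bell]
  simpa [construction] using h1 fun D => termCoeff {h.T} (stabSeq G D) m

end Hub

theorem stabSeq_singleton (i j : V) :
    stabSeq G {i} j = if j = i then 1 else by classical exact if G.Adj j i then -1 else 0 := by
  classical
  by_cases h : G.Adj j i <;> simp [stabSeq, Finset.filter_singleton, h]

/-- Products of stabilizers of the same colour: at each position the two factors do not clash,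
and equal factors cancel. -/
theorem stabSeq_symmDiff {K : ℕ} {c : G.Coloring (Fin K)} {D D' : Finset V} {k : Fin K}
    (hD : ∀ i ∈ D, c i = k) (hD' : ∀ i ∈ D', c i = k) (j : V) :
    (stabSeq G D j = 0 ∧ stabSeq G (symmDiff D D') j = stabSeq G D' j) ∨
    (stabSeq G D' j = 0 ∧ stabSeq G (symmDiff D D') j = stabSeq G D j) ∨
    (stabSeq G D j = stabSeq G D' j ∧ stabSeq G (symmDiff D D') j = 0) := by
  classical
  have hpar : Odd ((symmDiff D D').filter (G.Adj j)).card ↔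
      ¬ (Odd (D.filter (G.Adj j)).card ↔ Odd (D'.filter (G.Adj j)).card) := by
    have h1 : (symmDiff D D').filter (G.Adj j) =
        symmDiff (D.filter (G.Adj j)) (D'.filter (G.Adj j)) := by
      ext x; simp only [Finset.mem_filter, Finset.mem_symmDiff]; tauto
    have h2 : ∀ s t : Finset V, (symmDiff s t).card + 2 * (s ∩ t).card = s.card + t.card := by
      intro s t
      have h3 : (symmDiff s t).card = (s \ t).card + (t \ s).card := by
        rw [symmDiff_def]
        exact Finset.card_union_of_disjoint disjoint_sdiff_sdiff
      have h4 := Finset.card_sdiff_add_card_inter s t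
      have h5 := Finset.card_sdiff_add_card_inter t s
      rw [Finset.inter_comm] at h5
      omega
    have := h2 (D.filter (G.Adj j)) (D'.filter (G.Adj j))
    rw [h1]
    simp only [Nat.odd_iff]
    omega
  have h0 : ∀ E : Finset V, (∀ i ∈ E, c i = k) → c j = k → ¬ Odd (E.filter (G.Adj j)).card := by
    intro E hE hj
    rw [Finset.filter_false_of_mem]
    · simp
    · intro x hx hadj
      exact c.valid hadj (by rw [hE x hx, hj])
  simp only [stabSeq, Finset.mem_symmDiff]
  by_cases h1 : j ∈ D <;> by_cases h2 : j ∈ D'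
  · have := h0 D hD (hD j h1)
    have := h0 D' hD' (hD j h1)
    simp_all
  · have := h0 D' hD' (hD j h1)
    simp_all
  · have := h0 D hD (hD' j h2)
    simp_all
  · simp only [h1, h2, if_false, hpar]
    by_cases h3 : Odd (D.filter (G.Adj j)).card <;>
      by_cases h4 : Odd (D'.filter (G.Adj j)).card <;> simp [h3, h4]

/-- The eigenvalue of `Z` on a computational basis vector. -/
def zSign (a : Fin 2) : ℂ := if a = 1 then -1 else 1

open scoped Classical in
/-- The graph state is invariant under its generators `G_i`, in terms of its amplitudes. -/
theorem graphState_flip (x : V → Fin 2) (i : V) :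
    graphState G (Function.update x i (x i + 1)) =
      (∏ j, if G.Adj j i then zSign (x j) else 1) * graphState G x := by
  unfold graphState
  rw [← mul_assoc]
  congr 1
  set f : (V → Fin 2) → Sym2 V → ℂ := fun x e => if ∀ i ∈ e, x i = 1 then -1 else 1 with hf
  have hsq : ∀ x e, f x e * f x e = 1 := by
    intro x e; simp only [hf]; split_ifs <;> simp
  have hflip : ∀ e ∈ G.edgeFinset, f (Function.update x i (x i + 1)) e =
      (if i ∈ e then f (Function.update x i (x i + 1)) e * f x e else 1) * f x e := by
    intro e _
    split_ifs with h
    · rw [mul_assoc, hsq, mul_one]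
    · rw [one_mul]
      simp only [hf]
      congr 1
      refine propext (forall₂_congr fun j hj => ?_)
      rw [Function.update_of_ne]
      rintro rfl
      exact h hj
  show ∏ e ∈ G.edgeFinset, f (Function.update x i (x i + 1)) e = _ * ∏ e ∈ G.edgeFinset, f x e
  rw [Finset.prod_congr rfl hflip, Finset.prod_mul_distrib]
  congr 1
  rw [← Finset.prod_filter, ← Finset.prod_filter]
  symm
  refine Finset.prod_bij (fun j _ => s(j, i)) ?_ ?_ ?_ ?_
  · intro j hj; simpa using hj
  · intro j _ j' _ hjj
    exact Sym2.congr_left.mp hjj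
  · intro e he
    obtain ⟨he1, he2⟩ := Finset.mem_filter.mp he
    obtain ⟨j, rfl⟩ := Sym2.mem_iff_exists.mp he2
    refine ⟨j, ?_, Sym2.eq_swap⟩
    simpa [SimpleGraph.adj_comm] using he1
  · intro j hj
    have hadj : G.Adj j i := (Finset.mem_filter.mp hj).2
    have hji : j ≠ i := hadj.ne
    simp only [hf, zSign, Sym2.mem_iff, forall_eq_or_imp, forall_eq, Function.update_self,
      Function.update_of_ne hji]
    generalize x j = a
    generalize x i = b
    fin_cases a <;> fin_cases b <;> simp

end Combinatorics

/-! ### The quantum bound -/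

section QuantumBound

variable {V : Type} [Fintype V] [DecidableEq V]

theorem ofReal_inv_sqrt_two_mul_self :
    ((1 / √2 : ℝ) : ℂ) * ((1 / √2 : ℝ) : ℂ) = 1 / 2 := by
  rw [← Complex.ofReal_mul, div_mul_div_comm, Real.mul_self_sqrt (by norm_num)]
  norm_num

theorem pick_zero {α : Type} (o a b : α) : pick o a b 0 = o := rfl

theorem pick_one {α : Type} (o a b : α) : pick o a b 1 = a := rfl

theorem pick_neg_one {α : Type} (o a b : α) : pick o a b (-1) = b := rfl

/-- Completing the square. The observables of one party take a vector to `u` and `v`, the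
remaining parts of two stabilizers take it to `l` and `k`. -/
theorem pair_sum_of_squares {H : Type} [NormedAddCommGroup H] [InnerProductSpace ℂ H]
    {u v l k : H} {r : ℝ} (hu : ‖u‖ = r) (hv : ‖v‖ = r) (hl : ‖l‖ = r) (hk : ‖k‖ = r) :
    2 * √2 * r ^ 2 - ((inner ℂ (u + v) l).re + (inner ℂ (u - v) k).re) =
      (1 / √2) * (‖((1 / √2 : ℝ) : ℂ) • (u + v) - l‖ ^ 2 +
        ‖((1 / √2 : ℝ) : ℂ) • (u - v) - k‖ ^ 2) := by
  have h2 : √2 * √2 = 2 := Real.mul_self_sqrt (by norm_num)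
  have hpos : √2 ≠ 0 := by positivity
  have par := parallelogram_law_with_norm ℂ u v
  have e : ∀ w l : H, ‖((1 / √2 : ℝ) : ℂ) • w - l‖ ^ 2 =
      (1 / 2) * ‖w‖ ^ 2 - 2 * (1 / √2) * (inner ℂ w l).re + ‖l‖ ^ 2 := by
    intro w l
    have h3 := norm_sub_sq (𝕜 := ℂ) (((1 / √2 : ℝ) : ℂ) • w) l
    rw [h3, norm_smul, inner_smul_left, Complex.conj_ofReal]
    have h4 : RCLike.re (((1 / √2 : ℝ) : ℂ) * inner ℂ w l) = (1 / √2) * (inner ℂ w l).re :=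
      Complex.re_ofReal_mul _ _
    rw [h4, mul_pow, Complex.norm_real, Real.norm_eq_abs, sq_abs, div_pow,
      Real.sq_sqrt (by norm_num)]
    ring
  rw [e, e, hl, hk]
  rw [hu, hv] at par
  have h5 : (1 / √2) * (1 / √2) = 1 / 2 := by field_simp; linarith
  have h6 : 1 / √2 = √2 / 2 := by field_simp; linarith
  have h7 : ‖u + v‖ ^ 2 + ‖u - v‖ ^ 2 = 4 * r ^ 2 := by nlinarith
  rw [h6] at h5 ⊢
  linear_combination (-√2 / 4) * h7 + 2 * ((inner ℂ (u + v) l).re + (inner ℂ (u - v) k).re) * h5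

theorem norm_of_star_mul_self {α : Type} {T : L2 α →L[ℂ] L2 α} (hT : star T * T = 1) (ψ : L2 α) :
    ‖T ψ‖ = ‖ψ‖ := by
  rw [← sq_eq_sq₀ (norm_nonneg _) (norm_nonneg _)]
  have h1 : (inner ℂ (T ψ) (T ψ)).re = ‖T ψ‖ ^ 2 := inner_self_eq_norm_sq (𝕜 := ℂ) _
  have h2 : (inner ℂ ψ ψ).re = ‖ψ‖ ^ 2 := inner_self_eq_norm_sq (𝕜 := ℂ) ψ
  rw [← h1, ← h2, ← ContinuousLinearMap.adjoint_inner_right, ← ContinuousLinearMap.star_eq_adjoint,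
    ← mul_apply_eq_comp, hT, one_apply_eq_self]

namespace Realization

variable (Q : Realization V)

theorem star_pick_mul_self (i : V) (s : SignType) :
    star (pick 1 (Q.A i) (Q.B i) s) * pick 1 (Q.A i) (Q.B i) s = 1 := by
  rcases s with _ | _ | _
  · simp [pick]
  · simp [pick, (Q.B_selfAdjoint i).star_eq, Q.B_sq]
  · simp [pick, (Q.A_selfAdjoint i).star_eq, Q.A_sq]

theorem norm_obs (m : V → SignType) (ψ : L2 (∀ i, Q.κ i)) : ‖Q.obs m ψ‖ = ‖ψ‖ := by
  refine norm_of_star_mul_self ?_ ψ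
  unfold obs
  rw [star_tensorOp, ← tensorOp_mul, ← tensorOp_one]
  congr 1
  ext1 i
  exact Q.star_pick_mul_self i (m i)

/-- The operator of a Bell expression. -/
def bellOp (β : BellExpr V) : L2 (∀ i, Q.κ i) →L[ℂ] L2 (∀ i, Q.κ i) :=
  ∑ m, (β m : ℂ) • Q.obs m

theorem re_inner_bellOp (β : BellExpr V) (ψ : L2 (∀ i, Q.κ i)) :
    (inner ℂ ψ (Q.bellOp β ψ)).re = ∑ m, β m * (inner ℂ ψ (Q.obs m ψ)).re := by
  simp only [bellOp, sum_apply, inner_sum, Complex.re_sum, smul_apply, inner_smul_right,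
    Complex.re_ofReal_mul]

theorem hasSum_value (β : BellExpr V) :
    HasSum (fun e => (inner ℂ (Q.ψ e) (Q.bellOp β (Q.ψ e))).re) (Q.value β) := by
  have h1 : ∀ m, Summable fun e => (inner ℂ (Q.ψ e) (Q.obs m (Q.ψ e))).re := by
    intro m
    refine Summable.of_norm_bounded Q.norm_ψ.summable fun e => ?_
    calc ‖(inner ℂ (Q.ψ e) (Q.obs m (Q.ψ e))).re‖ ≤ ‖inner ℂ (Q.ψ e) (Q.obs m (Q.ψ e))‖ :=
          Complex.abs_re_le_norm _
      _ ≤ ‖Q.ψ e‖ * ‖Q.obs m (Q.ψ e)‖ := norm_inner_le_norm _ _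
      _ = ‖Q.ψ e‖ ^ 2 := by rw [norm_obs, sq]
  have h2 := hasSum_sum (s := Finset.univ) fun m _ => (h1 m).hasSum.mul_left (β m)
  simp only [re_inner_bellOp]
  exact h2

open scoped Classical in
/-- The local factor of the term of a stabilizer with sequence `s`. -/
def factor (AC : Finset V) (s : V → SignType) (i : V) : L2 (Q.κ i) →L[ℂ] L2 (Q.κ i) :=
  if i ∈ AC ∧ s i ≠ 0 then Q.A i + ((s i : ℝ) : ℂ) • Q.B i else pick 1 (Q.A i) (Q.B i) (s i)

/-- Expanding the product of the local factors gives the correlators of the term. -/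
theorem bellOp_termCoeff (AC : Finset V) (s : V → SignType) :
    Q.bellOp (termCoeff AC s) = tensorOp (Q.factor AC s) := by
  classical
  have h1 : Q.factor AC s = fun i => ∑ σ : SignType,
      ((if i ∈ AC ∧ s i ≠ 0 then pick 0 1 (s i : ℝ) σ else if σ = s i then 1 else 0 : ℝ) : ℂ) •
        pick 1 (Q.A i) (Q.B i) σ := by
    ext1 i
    unfold factor
    split_ifs with h
    · simp only [SignType.univ_eq]
      simp [pick_zero, pick_one, pick_neg_one, add_comm, -Complex.coe_smul]
    · simp only [apply_ite ((↑) : ℝ → ℂ), ite_smul]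
      simp
  rw [h1, tensorOp_sum_smul]
  refine Finset.sum_congr rfl fun m _ => ?_
  rw [termCoeff]
  push_cast
  rfl

/-- The operator in the role of `X` at party `i`: the sum of the observables, normalized, at the
positions with rotated observables. -/
def X (AC : Finset V) (i : V) : L2 (Q.κ i) →L[ℂ] L2 (Q.κ i) :=
  if i ∈ AC then ((1 / √2 : ℝ) : ℂ) • (Q.A i + Q.B i) else Q.A i

/-- The operator in the role of `Z` at party `i`: the difference of the observables, normalized,
at the positions with rotated observables. -/
def Z (AC : Finset V) (i : V) : L2 (Q.κ i) →L[ℂ] L2 (Q.κ i) :=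
  if i ∈ AC then ((1 / √2 : ℝ) : ℂ) • (Q.A i - Q.B i) else Q.B i

/-- The observables that a stabilizer with sequence `s` prescribes to the parties other
than `T`. -/
def restOp (T : V) (s : V → SignType) : L2 (∀ i, Q.κ i) →L[ℂ] L2 (∀ i, Q.κ i) :=
  Q.obs (Function.update s T 0)

theorem factor_eq_restOp {AC : Finset V} {T : V} {s : V → SignType} (hT : T ∈ AC)
    (hs : s T ≠ 0) (h0 : ∀ i ∈ AC, i ≠ T → s i = 0) :
    tensorOp (Q.factor AC s) = localOp T (Q.A T + ((s T : ℝ) : ℂ) • Q.B T) * Q.restOp T s := by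
  have h1 : (fun i => pick 1 (Q.A i) (Q.B i) (Function.update s T 0 i)) =
      Function.update (Q.factor AC s) T 1 := by
    ext1 i
    rcases eq_or_ne i T with rfl | h
    · simp; rfl
    · rw [Function.update_of_ne h, Function.update_of_ne h, factor, if_neg]
      rintro ⟨h1, h2⟩
      exact h2 (h0 i h1 h)
  rw [restOp, obs, h1, ← tensorOp_mul_localOp_comm _ _ (by simp), tensorOp_eq_mul_localOp _ T,
    factor, if_pos ⟨hT, hs⟩]

/-- The amount by which a pair of stabilizers misses the value `2√2`, as a sum of squares. -/
theorem pair_deficit {AC : Finset V} {T : V} {s s' : V → SignType} (hT : T ∈ AC)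
    (hs : s T = 1) (hs' : s' T = -1) (h0 : ∀ i ∈ AC, i ≠ T → s i = 0 ∧ s' i = 0)
    (ψ : L2 (∀ i, Q.κ i)) :
    2 * √2 * ‖ψ‖ ^ 2 - ((inner ℂ ψ (Q.bellOp (termCoeff AC s) ψ)).re +
        (inner ℂ ψ (Q.bellOp (termCoeff AC s') ψ)).re) =
      (1 / √2) * (‖localOp T (Q.X AC T) ψ - Q.restOp T s ψ‖ ^ 2 +
        ‖localOp T (Q.Z AC T) ψ - Q.restOp T s' ψ‖ ^ 2) := by
  have hadj : ∀ (S : L2 (Q.κ T) →L[ℂ] L2 (Q.κ T)), IsSelfAdjoint S →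
      ∀ φ, inner ℂ ψ (localOp T S φ) = inner ℂ (localOp T S ψ) φ := by
    intro S hS φ
    rw [← ContinuousLinearMap.adjoint_inner_left, ← ContinuousLinearMap.star_eq_adjoint,
      star_localOp, hS.star_eq]
  have hnorm : ∀ (S : L2 (Q.κ T) →L[ℂ] L2 (Q.κ T)), IsSelfAdjoint S → S * S = 1 →
      ‖localOp T S ψ‖ = ‖ψ‖ := by
    intro S hS h2
    refine norm_of_star_mul_self ?_ ψ
    rw [star_localOp, hS.star_eq, ← map_mul, h2, map_one]
  have hA := Q.A_selfAdjoint T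
  have hB := Q.B_selfAdjoint T
  rw [bellOp_termCoeff, bellOp_termCoeff,
    Q.factor_eq_restOp hT (by simp [hs]) fun i hi h => (h0 i hi h).1,
    Q.factor_eq_restOp hT (by simp [hs']) fun i hi h => (h0 i hi h).2, hs, hs',
    mul_apply_eq_comp, mul_apply_eq_comp]
  have e1 : Q.A T + (((1 : SignType) : ℝ) : ℂ) • Q.B T = Q.A T + Q.B T := by simp
  have e2 : Q.A T + (((-1 : SignType) : ℝ) : ℂ) • Q.B T = Q.A T - Q.B T := by
    simp [sub_eq_add_neg]
  rw [e1, e2, hadj _ (hA.add hB), hadj _ (hA.sub hB), X, Z, if_pos hT, if_pos hT, map_smul,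
    map_smul, map_add, map_sub]
  exact pair_sum_of_squares (hnorm _ hA (Q.A_sq T)) (hnorm _ hB (Q.B_sq T))
    (Q.norm_obs _ ψ) (Q.norm_obs _ ψ)

section Bound

variable {G : SimpleGraph V} {K : ℕ} {c : G.Coloring (Fin K)} (C : Construction G c)

theorem inner_bellOp (ψ : L2 (∀ i, Q.κ i)) : (inner ℂ ψ (Q.bellOp C.bell ψ)).re =
    ∑ p ∈ C.P, ((inner ℂ ψ (Q.bellOp (termCoeff C.AC (stabSeq G p.1)) ψ)).re +
      (inner ℂ ψ (Q.bellOp (termCoeff C.AC (stabSeq G p.2)) ψ)).re) +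
    ∑ D ∈ C.R, (inner ℂ ψ (Q.bellOp (termCoeff C.AC (stabSeq G D)) ψ)).re := by
  simp only [re_inner_bellOp, Construction.bell, add_mul, Finset.sum_mul, Finset.sum_add_distrib]
  congr 1
  · congr 1 <;> exact Finset.sum_comm
  · exact Finset.sum_comm

theorem pair_le {p : Finset V × Finset V} (hp : p ∈ C.P) (ψ : L2 (∀ i, Q.κ i)) :
    (inner ℂ ψ (Q.bellOp (termCoeff C.AC (stabSeq G p.1)) ψ)).re +
      (inner ℂ ψ (Q.bellOp (termCoeff C.AC (stabSeq G p.2)) ψ)).re ≤ 2 * √2 * ‖ψ‖ ^ 2 := by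
  obtain ⟨T, hT, h1, h2, h0⟩ := C.pair p hp
  have := Q.pair_deficit hT h1 h2 h0 ψ
  have h3 : 0 ≤ (1 / √2) * (‖localOp T (Q.X C.AC T) ψ - Q.restOp T (stabSeq G p.1) ψ‖ ^ 2 +
        ‖localOp T (Q.Z C.AC T) ψ - Q.restOp T (stabSeq G p.2) ψ‖ ^ 2) := by positivity
  linarith

theorem rest_le {D : Finset V} (hD : D ∈ C.R) (ψ : L2 (∀ i, Q.κ i)) :
    (inner ℂ ψ (Q.bellOp (termCoeff C.AC (stabSeq G D)) ψ)).re ≤ ‖ψ‖ ^ 2 := by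
  have h1 : tensorOp (Q.factor C.AC (stabSeq G D)) = Q.obs (stabSeq G D) := by
    unfold obs
    congr 1
    ext1 i
    rw [factor, if_neg]
    rintro ⟨h1, h2⟩
    exact h2 (C.rest D hD i h1)
  rw [bellOp_termCoeff, h1]
  calc _ ≤ ‖inner ℂ ψ (Q.obs (stabSeq G D) ψ)‖ := Complex.re_le_norm _
    _ ≤ ‖ψ‖ * ‖Q.obs (stabSeq G D) ψ‖ := norm_inner_le_norm _ _
    _ = ‖ψ‖ ^ 2 := by rw [norm_obs, sq]

theorem inner_bellOp_le (ψ : L2 (∀ i, Q.κ i)) :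
    (inner ℂ ψ (Q.bellOp C.bell ψ)).re ≤ (2 * √2 * C.P.card + C.R.card) * ‖ψ‖ ^ 2 := by
  rw [inner_bellOp]
  have h1 := Finset.sum_le_sum fun p hp => Q.pair_le C (p := p) hp ψ
  have h2 := Finset.sum_le_sum fun D hD => Q.rest_le C (D := D) hD ψ
  simp only [Finset.sum_const, nsmul_eq_mul] at h1 h2
  linarith

/-- The quantum bound: `2√2` for each pair of stabilizers and `1` for each other stabilizer. -/
theorem value_le : Q.value C.bell ≤ 2 * √2 * C.P.card + C.R.card := by
  have h := Q.norm_ψ.mul_left (2 * √2 * C.P.card + C.R.card : ℝ)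
  rw [mul_one] at h
  exact hasSum_le (fun e => Q.inner_bellOp_le C (Q.ψ e)) (Q.hasSum_value C.bell) h

/-- A realization that reaches the quantum bound makes all the squares vanish. -/
theorem eq_restOp_of_value_eq (hQ : Q.value C.bell = 2 * √2 * C.P.card + C.R.card)
    {p : Finset V × Finset V} (hp : p ∈ C.P) {T : V} (hT : T ∈ C.AC)
    (h1 : stabSeq G p.1 T = 1) (h2 : stabSeq G p.2 T = -1)
    (h0 : ∀ i ∈ C.AC, i ≠ T → stabSeq G p.1 i = 0 ∧ stabSeq G p.2 i = 0) (e : Q.E) :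
    localOp T (Q.X C.AC T) (Q.ψ e) = Q.restOp T (stabSeq G p.1) (Q.ψ e) ∧
      localOp T (Q.Z C.AC T) (Q.ψ e) = Q.restOp T (stabSeq G p.2) (Q.ψ e) := by
  have hs := Q.norm_ψ.mul_left (2 * √2 * C.P.card + C.R.card : ℝ)
  rw [mul_one] at hs
  -- The nonnegative deficits of the components of the state sum to zero.
  have hz := hs.sub (Q.hasSum_value C.bell)
  rw [hQ, sub_self, hasSum_zero_iff_of_nonneg
    fun e => sub_nonneg.mpr (Q.inner_bellOp_le C (Q.ψ e))] at hz
  have he : (2 * √2 * C.P.card + C.R.card) * ‖Q.ψ e‖ ^ 2 -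
      (inner ℂ (Q.ψ e) (Q.bellOp C.bell (Q.ψ e))).re = 0 := congrFun hz e
  rw [inner_bellOp] at he
  have hR := Finset.sum_le_sum fun D hD => Q.rest_le C (D := D) hD (Q.ψ e)
  have hP : ∑ p ∈ C.P, ((inner ℂ (Q.ψ e) (Q.bellOp (termCoeff C.AC (stabSeq G p.1)) (Q.ψ e))).re +
      (inner ℂ (Q.ψ e) (Q.bellOp (termCoeff C.AC (stabSeq G p.2)) (Q.ψ e))).re) =
      ∑ p ∈ C.P, 2 * √2 * ‖Q.ψ e‖ ^ 2 := by
    refine le_antisymm (Finset.sum_le_sum fun p hp => Q.pair_le C hp _) ?_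
    simp only [Finset.sum_const, nsmul_eq_mul] at hR ⊢
    linarith
  have hp' := (Finset.sum_eq_sum_iff_of_le fun p hp => Q.pair_le C hp (Q.ψ e)).mp hP p hp
  have hd := Q.pair_deficit hT h1 h2 h0 (Q.ψ e)
  rw [hp', sub_self, eq_comm, mul_eq_zero,
    add_eq_zero_iff_of_nonneg (by positivity) (by positivity)] at hd
  simpa [sub_eq_zero] using hd

end Bound

end Realization

end QuantumBound

/-! ### Stabilizer equations and anticommutation -/

section Stabilizers

variable {V : Type} [Fintype V] [DecidableEq V] {κ : V → Type} {G : SimpleGraph V}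

/-- The stabilizer with sequence `s`, for given operators `X` and `Z` of all parties. -/
def pauliOp (X Z : ∀ i, L2 (κ i) →L[ℂ] L2 (κ i)) (s : V → SignType) :
    L2 (∀ i, κ i) →L[ℂ] L2 (∀ i, κ i) :=
  tensorOp fun i => pick 1 (X i) (Z i) (s i)

variable {X Z : ∀ i, L2 (κ i) →L[ℂ] L2 (κ i)} {ψ : L2 (∀ i, κ i)}

theorem pauliOp_symmDiff (hX : ∀ i, localOp i (X i * X i) ψ = ψ)
    (hZ : ∀ i, localOp i (Z i * Z i) ψ = ψ) {K : ℕ} {c : G.Coloring (Fin K)} {D D' : Finset V}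
    {k : Fin K} (hD : ∀ i ∈ D, c i = k) (hD' : ∀ i ∈ D', c i = k) :
    pauliOp X Z (stabSeq G D) (pauliOp X Z (stabSeq G D') ψ) =
      pauliOp X Z (stabSeq G (symmDiff D D')) ψ := by
  unfold pauliOp
  rw [← mul_apply_eq_comp, ← tensorOp_mul]
  refine tensorOp_apply_congr fun j => ?_
  rw [Pi.mul_apply]
  rcases stabSeq_symmDiff hD hD' j with ⟨h1, h2⟩ | ⟨h1, h2⟩ | ⟨h1, h2⟩
  · rw [h1, h2, pick_zero, one_mul]
  · rw [h1, h2, pick_zero, mul_one]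
  · rw [h1, h2, pick_zero, map_one, one_apply_eq_self]
    rcases stabSeq G D' j with _ | _ | _
    · simp [pick]
    · exact hZ j
    · exact hX j

theorem Hub.gens_eq {K : ℕ} {c : G.Coloring (Fin K)} (h : Hub G c) (i : V) :
    h.gens i = {i} ∨ h.gens i = symmDiff {i} {h.rep (c i)} ∧
      h.gens (h.rep (c i)) = {h.rep (c i)} := by
  classical
  have hrep : h.rep (c i) = h.T ∨ G.Adj h.T (h.rep (c i)) := by
    by_cases hi : c i = c h.T
    · left; rw [hi, h.rep_self]
    · exact Or.inr (h.adj_rep _ hi)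
  by_cases h1 : i = h.T ∨ G.Adj h.T i
  · left; simp [Hub.gens, h1]
  · right
    have hne : i ≠ h.rep (c i) := by
      intro h2
      rw [h2] at h1
      rw [← h2] at hrep
      exact h1 (h2 ▸ hrep)
    refine ⟨?_, by simp [Hub.gens, hrep]⟩
    rw [Hub.gens, if_neg h1]
    ext x
    simp only [Finset.mem_symmDiff, Finset.mem_insert, Finset.mem_singleton]
    constructor
    · rintro (rfl | rfl)
      · exact Or.inl ⟨rfl, hne⟩
      · exact Or.inr ⟨rfl, hne.symm⟩
    · rintro (h | h)
      · exact Or.inl h.1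
      · exact Or.inr h.1

/-- The stabilizers attached to the vertices by a hub stabilize a vector if and only if the
generators do. -/
theorem Hub.stabilizes_iff {K : ℕ} {c : G.Coloring (Fin K)} (h : Hub G c)
    (hX : ∀ i, localOp i (X i * X i) ψ = ψ) (hZ : ∀ i, localOp i (Z i * Z i) ψ = ψ) :
    (∀ i, pauliOp X Z (stabSeq G (h.gens i)) ψ = ψ) ↔
      ∀ i, pauliOp X Z (stabSeq G {i}) ψ = ψ := by
  have hrep : ∀ i, ∀ j ∈ ({h.rep (c i)} : Finset V), c j = c i := by
    intro i j hj
    rw [Finset.mem_singleton.mp hj, h.colour_rep]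
  constructor
  · intro hs i
    rcases h.gens_eq i with h1 | ⟨h1, h2⟩
    · rw [← h1]; exact hs i
    · have h3 := pauliOp_symmDiff hX hZ (fun j => h.colour_of_mem_gens (i := i)) (hrep i)
      rw [← h2, hs, hs, h2, h1, symmDiff_symmDiff_cancel_right] at h3
      exact h3.symm
  · intro hs i
    rcases h.gens_eq i with h1 | ⟨h1, -⟩
    · rw [h1]; exact hs i
    · have h3 := pauliOp_symmDiff (G := G) (D := {i}) hX hZ (c := c) (k := c i) (by simp) (hrep i)
      rw [hs, hs, ← h1] at h3
      exact h3.symm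

/-- Anticommutation passes from a vertex to its neighbours. The generators of two adjacent
vertices `i` and `j` express `X j` and `Z j` on the state through operators of the other parties,
which differ in order only by the factors `X i` and `Z i`. -/
theorem anticomm_of_adj {i j : V} (hij : G.Adj i j)
    (hXj : localOp j (X j * X j) ψ = ψ) (hZj : localOp j (Z j * Z j) ψ = ψ)
    (hgi : pauliOp X Z (stabSeq G {i}) ψ = ψ) (hgj : pauliOp X Z (stabSeq G {j}) ψ = ψ)
    (hi : localOp i (X i * Z i + Z i * X i) ψ = 0) :
    localOp j (X j * Z j + Z j * X j) ψ = 0 := by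
  classical
  set e : ∀ k, L2 (κ k) →L[ℂ] L2 (κ k) :=
    Function.update (fun k => pick 1 (X k) (Z k) (stabSeq G {i} k)) j 1 with he
  set f : ∀ k, L2 (κ k) →L[ℂ] L2 (κ k) :=
    Function.update (fun k => pick 1 (X k) (Z k) (stabSeq G {j} k)) j 1 with hf
  have hne : i ≠ j := hij.ne
  have hsj : stabSeq G {i} j = -1 := by simp [stabSeq_singleton, hne.symm, hij.symm]
  have hsi : stabSeq G {j} i = -1 := by simp [stabSeq_singleton, hne, hij]
  have hE : ∀ S φ, tensorOp e (localOp j S φ) = localOp j S (tensorOp e φ) := fun S φ => by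
    rw [← mul_apply_eq_comp, tensorOp_mul_localOp_comm _ _ (by simp [he]), mul_apply_eq_comp]
  have hF : ∀ S φ, tensorOp f (localOp j S φ) = localOp j S (tensorOp f φ) := fun S φ => by
    rw [← mul_apply_eq_comp, tensorOp_mul_localOp_comm _ _ (by simp [hf]), mul_apply_eq_comp]
  have hEZ : tensorOp e (localOp j (Z j) ψ) = ψ := by
    have := hgi
    rw [pauliOp, tensorOp_eq_mul_localOp _ j, hsj, pick_neg_one] at this
    exact this
  have hFX : tensorOp f (localOp j (X j) ψ) = ψ := by
    have := hgj
    rw [pauliOp, tensorOp_eq_mul_localOp _ j, show stabSeq G {j} j = 1 by simp [stabSeq],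
      pick_one] at this
    exact this
  -- On the state, `Z j` acts as `e` and `X j` as `f`, which are trivial at `j`.
  have hZe : localOp j (Z j) ψ = tensorOp e ψ := by
    conv_lhs => rw [← hEZ]
    rw [← hE, ← mul_apply_eq_comp (localOp j (Z j)), ← map_mul, hZj]
  have hXf : localOp j (X j) ψ = tensorOp f ψ := by
    conv_lhs => rw [← hFX]
    rw [← hF, ← mul_apply_eq_comp (localOp j (X j)), ← map_mul, hXj]
  -- Away from `i`, both `e` and `f` consist of factors `Z` and `1`, so they commute there.
  have hcomm : Function.update (e * f) i 1 = Function.update (f * e) i 1 := by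
    ext1 k
    rcases eq_or_ne k i with rfl | hk
    · simp
    rw [Function.update_of_ne hk, Function.update_of_ne hk, Pi.mul_apply, Pi.mul_apply]
    rcases eq_or_ne k j with rfl | hkj
    · simp [he, hf]
    · simp only [he, hf, Function.update_of_ne hkj, stabSeq_singleton, if_neg hk, if_neg hkj]
      split_ifs <;> simp [pick_zero]
  have hei : e i = X i := by simp [he, hne, stabSeq, pick_one]
  have hfi : f i = Z i := by simp [hf, hne, hsi, pick_neg_one]
  rw [map_add, map_mul, map_mul, add_apply, mul_apply_eq_comp, mul_apply_eq_comp, hZe, hXf,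
    ← hE, ← hF, hZe, hXf, ← mul_apply_eq_comp, ← mul_apply_eq_comp (tensorOp f), ← tensorOp_mul,
    ← tensorOp_mul, tensorOp_eq_mul_localOp (e * f) i, tensorOp_eq_mul_localOp (f * e) i, hcomm,
    mul_apply_eq_comp, mul_apply_eq_comp, ← map_add, Pi.mul_apply, Pi.mul_apply, hei, hfi,
    ← add_apply, ← map_add, hi, map_zero]

theorem anticomm_of_connected (hG : G.Connected) (hX : ∀ i, localOp i (X i * X i) ψ = ψ)
    (hZ : ∀ i, localOp i (Z i * Z i) ψ = ψ) (hg : ∀ i, pauliOp X Z (stabSeq G {i}) ψ = ψ) {T : V}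
    (hT : localOp T (X T * Z T + Z T * X T) ψ = 0) (i : V) :
    localOp i (X i * Z i + Z i * X i) ψ = 0 := by
  have h := (SimpleGraph.reachable_iff_reflTransGen T i).mp (hG.preconnected T i)
  induction h with
  | refl => exact hT
  | tail _ hjk ih => exact anticomm_of_adj hjk (hX _) (hZ _) (hg _) (hg _) ih

end Stabilizers

/-! ### Local isometries -/

section Isometry

variable {α : Type} {A B : L2 α →L[ℂ] L2 α}

/-- Two observables that anticommute on a state are taken to the Pauli matrices `X` and `Z` by an
isometry with components `W 0` and `W 1`: the error terms vanish where `A` and `B` anticommute. -/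
theorem exists_swap (hA : IsSelfAdjoint A) (hB : IsSelfAdjoint B) (hA2 : A * A = 1)
    (hB2 : B * B = 1) : ∃ W : Fin 2 → L2 α →L[ℂ] L2 α,
      star (W 0) * W 0 + star (W 1) * W 1 = 1 ∧ W 0 * B = W 0 ∧ W 1 * B = -W 1 ∧
      (∃ R, W 0 * A = W 1 + R * (A * B + B * A)) ∧
      ∃ R, W 1 * A = W 0 + R * (A * B + B * A) := by
  have hABB : A * B * B = A := by rw [mul_assoc, hB2, mul_one]
  have hAAB : A * (A * B) = B := by rw [← mul_assoc, hA2, one_mul]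
  -- The isometry projects onto an eigenspace of `B`, and `A` brings the second one to the first.
  refine ⟨![(1 / 2 : ℂ) • (1 + B), (1 / 2 : ℂ) • (A - A * B)], ?_, ?_, ?_,
    ⟨(1 / 2 : ℂ) • 1, ?_⟩, ⟨(-1 / 2 : ℂ) • A, ?_⟩⟩
  · have h1 : (1 + B) * (1 + B) = (2 : ℂ) • (1 + B) := by
      simp only [mul_add, add_mul, one_mul, mul_one, hB2]; module
    have h2 : (A - B * A) * (A - A * B) = (2 : ℂ) • (1 - B) := by
      have h3 : B * A * A = B := by rw [mul_assoc, hA2, mul_one]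
      have h4 : B * A * (A * B) = 1 := by rw [← mul_assoc, h3, hB2]
      simp only [mul_sub, sub_mul, hA2, h3, h4, hAAB]; module
    simp only [Matrix.cons_val_zero, Matrix.cons_val_one, star_smul, star_add, star_sub, star_mul,
      star_one, hA.star_eq, hB.star_eq, smul_mul_smul_comm, h1, h2]
    simp only [one_div, star_inv₀, star_ofNat, smul_smul]
    norm_num
    module
  · simp [add_mul, hB2, add_comm]
  · rw [Matrix.cons_val_one, Matrix.cons_val_fin_one, smul_mul_assoc, sub_mul, hABB]
    module
  · simp only [Matrix.cons_val_zero, Matrix.cons_val_one, smul_mul_assoc, add_mul, one_mul]; module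
  · simp only [Matrix.cons_val_zero, Matrix.cons_val_one, smul_mul_assoc, sub_mul, mul_add, hA2,
      hAAB, mul_assoc]
    module

/-- The isometry of a party that does not rotate its observables. -/
theorem exists_isometry (hA : IsSelfAdjoint A) (hB : IsSelfAdjoint B) (hA2 : A * A = 1)
    (hB2 : B * B = 1) : ∃ W : Fin 2 → L2 α →L[ℂ] L2 α, ∑ a, star (W a) * W a = 1 ∧
      ∀ s a, ∃ R : L2 α →L[ℂ] L2 α, W a * pick 1 A B s =
        ∑ b, pick 1 pauliX pauliZ s a b • W b + R * (A * B + B * A) := by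
  obtain ⟨W, h1, h2, h3, ⟨R, h4⟩, ⟨R', h5⟩⟩ := exists_swap hA hB hA2 hB2
  refine ⟨W, by simpa using h1, fun s => Fin.forall_fin_two.mpr ?_⟩
  simp only [Fin.sum_univ_two]
  rcases s with _ | _ | _
  · exact ⟨⟨0, by simp [pick]⟩, ⟨0, by simp [pick]⟩⟩
  · exact ⟨⟨0, by simpa [pick, pauliZ] using h2⟩, ⟨0, by simpa [pick, pauliZ] using h3⟩⟩
  · exact ⟨⟨R, by simpa [pick, pauliX] using h4⟩, ⟨R', by simpa [pick, pauliX] using h5⟩⟩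

/-- The isometry of a party that rotates its observables. With `A` and `-B` in the roles of `Z`
and `X`, the components are rotated by the reflection that takes `Z` and `-X` to
`(X + Z) / √2` and `(X - Z) / √2`. -/
theorem exists_isometry_rotated (hA : IsSelfAdjoint A) (hB : IsSelfAdjoint B) (hA2 : A * A = 1)
    (hB2 : B * B = 1) : ∃ W : Fin 2 → L2 α →L[ℂ] L2 α, ∑ a, star (W a) * W a = 1 ∧
      ∀ s a, ∃ R : L2 α →L[ℂ] L2 α, W a * pick 1 A B s =
        ∑ b, pick 1 (((1 / √2 : ℝ) : ℂ) • (pauliX + pauliZ))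
          (((1 / √2 : ℝ) : ℂ) • (pauliX - pauliZ)) s a b • W b + R * (A * B + B * A) := by
  obtain ⟨U, h1, h2, h3, ⟨R, h4⟩, ⟨R', h5⟩⟩ := exists_swap hB.neg hA (by simpa using hB2) hA2
  obtain ⟨c, s, hcs, hc, hs⟩ : ∃ c s : ℝ, c ^ 2 + s ^ 2 = 1 ∧ c ^ 2 - s ^ 2 = 1 / √2 ∧
      2 * c * s = 1 / √2 := by
    have hq : 1 / √2 = √2 / 2 := by
      have h2 : √2 * √2 = 2 := Real.mul_self_sqrt (by norm_num)
      field_simp; linarith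
    refine ⟨Real.cos (Real.pi / 8), Real.sin (Real.pi / 8), Real.cos_sq_add_sin_sq _, ?_, ?_⟩
    · rw [← Real.cos_two_mul', hq, ← Real.cos_pi_div_four]; congr 1; ring
    · rw [mul_assoc, mul_comm (Real.cos _), ← mul_assoc, ← Real.sin_two_mul, hq,
        ← Real.sin_pi_div_four]
      congr 1; ring
  have hcs' : (c : ℂ) ^ 2 + (s : ℂ) ^ 2 = 1 := by exact_mod_cast hcs
  have hc' : (c : ℂ) ^ 2 - (s : ℂ) ^ 2 = ((1 / √2 : ℝ) : ℂ) := by exact_mod_cast hc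
  have hs' : 2 * (c : ℂ) * (s : ℂ) = ((1 / √2 : ℝ) : ℂ) := by exact_mod_cast hs
  generalize ((1 / √2 : ℝ) : ℂ) = r at hc' hs' ⊢
  have e1 : r * c + r * s = c := by
    linear_combination (-c : ℂ) * hc' - s * hs' + c * hcs'
  have e2 : r * c - r * s = s := by
    linear_combination (s : ℂ) * hc' - c * hs' + s * hcs'
  have hanti : -B * A + A * -B = -(A * B + B * A) := by noncomm_ring
  rw [mul_neg, neg_eq_iff_eq_neg, hanti, mul_neg, neg_add, neg_neg] at h4 h5
  refine ⟨![(c : ℂ) • U 0 + (s : ℂ) • U 1, (s : ℂ) • U 0 - (c : ℂ) • U 1], ?_,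
    fun t => Fin.forall_fin_two.mpr ?_⟩
  · rw [Fin.sum_univ_two, ← h1]
    simp only [Matrix.cons_val_zero, Matrix.cons_val_one, Matrix.cons_val_fin_one, star_add,
      star_sub, star_smul, Complex.star_def, Complex.conj_ofReal, add_mul, mul_add, sub_mul,
      mul_sub, smul_mul_smul_comm]
    match_scalars <;> first | ring1 | linear_combination hcs'
  · simp only [Fin.sum_univ_two, Matrix.cons_val_zero, Matrix.cons_val_one,
      Matrix.cons_val_fin_one]
    rcases t with _ | _ | _
    · exact ⟨⟨0, by simp [pick, -Complex.coe_smul]⟩, ⟨0, by simp [pick, -Complex.coe_smul]⟩⟩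
    · refine ⟨⟨(c : ℂ) • R + (s : ℂ) • R', ?_⟩, ⟨(s : ℂ) • R - (c : ℂ) • R', ?_⟩⟩
      · simp only [pick, add_mul, smul_mul_assoc, h4, h5]
        simp [pauliX, pauliZ, -Complex.coe_smul]
        match_scalars <;>
          first | ring1 | linear_combination e1 | linear_combination -e1 | linear_combination e2
      · simp only [pick, sub_mul, smul_mul_assoc, h4, h5]
        simp [pauliX, pauliZ, -Complex.coe_smul]
        match_scalars <;>
          first | ring1 | linear_combination e1 | linear_combination -e1 | linear_combination e2
    · refine ⟨⟨0, ?_⟩, ⟨0, ?_⟩⟩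
      · simp only [pick, add_mul, smul_mul_assoc, h2, h3]
        simp [pauliX, pauliZ, -Complex.coe_smul]
        match_scalars <;>
          first | ring1 | linear_combination e1 | linear_combination -e1 | linear_combination e2
      · simp only [pick, sub_mul, smul_mul_assoc, h2, h3]
        simp [pauliX, pauliZ, -Complex.coe_smul]
        match_scalars <;>
          first | ring1 | linear_combination e1 | linear_combination -e1 | linear_combination e2 |
            linear_combination -e2

end Isometry

/-! ### Self-testing -/

section SelfTest

variable {V : Type} [Fintype V] [DecidableEq V] {κ : V → Type} {G : SimpleGraph V}

open scoped Classical in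
/-- The sign that relates the amplitudes at `x` and at `x` with bit `i` flipped. -/
def flipSign (G : SimpleGraph V) (i : V) (x : V → Fin 2) : ℂ :=
  ∏ j, if G.Adj j i then zSign (x j) else 1

theorem zSign_mul_self (a : Fin 2) : zSign a * zSign a = 1 := by
  unfold zSign; split_ifs <;> simp

theorem flipSign_mul_self (i : V) (x : V → Fin 2) : flipSign G i x * flipSign G i x = 1 := by
  rw [flipSign, ← Finset.prod_mul_distrib]
  refine Finset.prod_eq_one fun j _ => ?_
  split_ifs
  · exact zSign_mul_self _
  · simp

theorem graphState_zero : graphState G 0 * ((√2 ^ Fintype.card V : ℝ) : ℂ) = 1 := by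
  have h : ((1 / √2 : ℝ) : ℂ) * ((√2 : ℝ) : ℂ) = 1 := by
    rw [← Complex.ofReal_mul, one_div, inv_mul_cancel₀ (by positivity), Complex.ofReal_one]
  have h0 : ∀ e : Sym2 V, (if ∀ i ∈ e, (0 : V → Fin 2) i = 1 then (-1 : ℂ) else 1) = 1 := by
    intro e
    rw [if_neg]
    intro h
    induction e with
    | _ a b => exact absurd (h a (by simp)) (by simp)
  rw [graphState, Complex.ofReal_pow]
  rw [Finset.prod_const, Finset.card_univ, mul_assoc, ← mul_pow, h, one_pow, mul_one]
  exact Finset.prod_eq_one fun e _ => h0 e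

theorem norm_graphState_sq (x : V → Fin 2) :
    ‖graphState G x‖ ^ 2 = (1 / 2) ^ Fintype.card V := by
  have h1 : ∀ e : Sym2 V, ‖(if ∀ i ∈ e, x i = 1 then (-1 : ℂ) else 1)‖ = 1 := by
    intro e
    split_ifs <;> simp
  have h2 : ‖((1 / √2 : ℝ) : ℂ)‖ ^ 2 = 1 / 2 := by
    rw [Complex.norm_real, Real.norm_eq_abs, sq_abs, div_pow, Real.sq_sqrt (by norm_num), one_pow]
  rw [graphState, norm_mul, norm_prod, norm_prod, Finset.prod_const, Finset.card_univ, mul_pow,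
    ← pow_mul, mul_comm _ 2, pow_mul, h2]
  rw [Finset.prod_eq_one fun e _ => h1 e]
  simp

theorem sum_norm_graphState_sq : ∑ x, ‖graphState G x‖ ^ 2 = 1 := by
  simp only [norm_graphState_sq, Finset.sum_const, Finset.card_univ, Fintype.card_fun,
    Fintype.card_fin, nsmul_eq_mul]
  push_cast
  rw [← mul_pow]
  norm_num

/-- A family of vectors with the stabilizer symmetries of the graph state is the graph state,
tensored with some vector. -/
theorem eq_graphState_smul {H : Type} [AddCommGroup H] [Module ℂ H] {w : (V → Fin 2) → H}
    (hw : ∀ i x, w x = flipSign G i x • w (Function.update x i (x i + 1))) (x : V → Fin 2) :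
    w x = graphState G x • ((√2 ^ Fintype.card V : ℝ) : ℂ) • w 0 := by
  have key : ∀ (s : Finset V) (x : V → Fin 2), (∀ i, i ∉ s → x i = 0) →
      w x = graphState G x • ((√2 ^ Fintype.card V : ℝ) : ℂ) • w 0 := by
    intro s
    induction s using Finset.induction_on with
    | empty =>
      intro x hx
      obtain rfl : x = 0 := funext fun i => hx i (Finset.notMem_empty i)
      rw [smul_smul, graphState_zero, one_smul]
    | insert i s hi ih =>
      intro x hx
      by_cases hxi : x i = 0
      · refine ih x fun j hj => ?_
        by_cases hji : j = i
        · rw [hji, hxi]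
        · exact hx j (by simp [hj, hji])
      -- Flipping bit `i` reduces to a smaller support.
      · have h1 : x i + 1 = 0 := by
          revert hxi; generalize x i = a; revert a; decide
        have h2 := ih (Function.update x i (x i + 1)) fun j hj => by
          by_cases hji : j = i
          · rw [hji, Function.update_self, h1]
          · rw [Function.update_of_ne hji]
            exact hx j (by simp [hj, hji])
        have h3 : graphState G (Function.update x i (x i + 1)) =
            flipSign G i x * graphState G x := graphState_flip x i
        rw [hw i x, h2, h3, smul_smul, ← mul_assoc, flipSign_mul_self, one_mul]
  exact key Finset.univ x fun i hi => absurd (Finset.mem_univ i) hi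

namespace Realization

variable (Q : Realization V) {AC : Finset V} {ψ : L2 (∀ i, Q.κ i)}

theorem exists_isometries (Q : Realization V) (AC : Finset V) :
    ∃ W : ∀ i, Fin 2 → L2 (Q.κ i) →L[ℂ] L2 (Q.κ i), ∀ i, ∑ a, star (W i a) * W i a = 1 ∧
      ∀ s a, ∃ R : L2 (Q.κ i) →L[ℂ] L2 (Q.κ i), W i a * pick 1 (Q.A i) (Q.B i) s =
        ∑ b, refObs AC i s a b • W i b + R * (Q.A i * Q.B i + Q.B i * Q.A i) := by
  have h : ∀ i, ∃ W : Fin 2 → L2 (Q.κ i) →L[ℂ] L2 (Q.κ i), ∑ a, star (W a) * W a = 1 ∧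
      ∀ s a, ∃ R : L2 (Q.κ i) →L[ℂ] L2 (Q.κ i), W a * pick 1 (Q.A i) (Q.B i) s =
        ∑ b, refObs AC i s a b • W b + R * (Q.A i * Q.B i + Q.B i * Q.A i) := by
    intro i
    unfold refObs
    split_ifs with hi
    · exact exists_isometry_rotated (Q.A_selfAdjoint i) (Q.B_selfAdjoint i) (Q.A_sq i) (Q.B_sq i)
    · exact exists_isometry (Q.A_selfAdjoint i) (Q.B_selfAdjoint i) (Q.A_sq i) (Q.B_sq i)
  choose W hW using h
  exact ⟨W, hW⟩

/-- The local isometries take the operators in the roles of `X` and `Z` to the Pauli matrices. -/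
theorem isometry_X_Z {W : ∀ i, Fin 2 → L2 (Q.κ i) →L[ℂ] L2 (Q.κ i)}
    (hO : ∀ i s a, localOp i (W i a * pick 1 (Q.A i) (Q.B i) s) ψ =
      localOp i (∑ b, refObs AC i s a b • W i b) ψ) (i : V) (a : Fin 2) :
    localOp i (W i a * Q.X AC i) ψ = localOp i (W i (a + 1)) ψ ∧
      localOp i (W i a * Q.Z AC i) ψ = zSign a • localOp i (W i a) ψ := by
  have hA := hO i 1 a
  have hB := hO i (-1) a
  rw [pick_one] at hA
  rw [pick_neg_one] at hB
  by_cases hi : i ∈ AC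
  · have h2 := ofReal_inv_sqrt_two_mul_self
    rw [X, Z, if_pos hi, if_pos hi, mul_smul_comm, mul_smul_comm, mul_add, mul_sub, map_smul,
      map_smul, map_add, map_sub, smul_apply, smul_apply, add_apply, sub_apply, hA, hB]
    simp only [refObs, if_pos hi, pick_one, pick_neg_one, Fin.sum_univ_two, map_add, map_smul,
      add_apply, smul_apply, Matrix.smul_apply, smul_eq_mul]
    generalize ((1 / √2 : ℝ) : ℂ) = r at h2
    clear hA hB
    fin_cases a <;> constructor <;> simp [pauliX, pauliZ, zSign] <;> match_scalars <;>
      first | ring1 | linear_combination 2 * h2 | linear_combination -2 * h2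
  · rw [X, Z, if_neg hi, if_neg hi, hA, hB]
    simp only [refObs, if_neg hi, pick_one, pick_neg_one, Fin.sum_univ_two]
    fin_cases a <;> simp [pauliX, pauliZ, zSign]

/-- If the operators in the roles of `X` and `Z` satisfy the stabilizer equations and anticommute
on the state, then isometries that rotate the observables of a party to the reference observables
map the state to the graph state. -/
theorem selfTest_of_stabilizes {W : ∀ i, Fin 2 → L2 (Q.κ i) →L[ℂ] L2 (Q.κ i)}
    (hW : ∀ i, ∑ a, star (W i a) * W i a = 1)
    (hO : ∀ i s a, localOp i (W i a * pick 1 (Q.A i) (Q.B i) s) ψ =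
      localOp i (∑ b, refObs AC i s a b • W i b) ψ)
    (hg : ∀ i, pauliOp (Q.X AC) (Q.Z AC) (stabSeq G {i}) ψ = ψ) :
    ∃ extra : L2 (∀ i, Q.κ i), ‖extra‖ ^ 2 = ‖ψ‖ ^ 2 ∧
      ∀ m a, tensorOp (fun i => W i (a i)) (Q.obs m ψ) = refVector G AC m a • extra := by
  classical
  set w : (V → Fin 2) → L2 (∀ i, Q.κ i) := fun a => tensorOp (fun i => W i (a i)) ψ with hw
  have hflip : ∀ i x, w x = flipSign G i x • w (Function.update x i (x i + 1)) := by
    intro i x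
    simp only [hw]
    -- Insert the generator `G_i` in front of the state and let the isometries absorb it.
    conv_lhs => rw [← hg i]
    rw [pauliOp, ← mul_apply_eq_comp, ← tensorOp_mul, flipSign, ← smul_apply, ← tensorOp_smul]
    refine tensorOp_apply_congr fun j => ?_
    rw [Pi.mul_apply, stabSeq_singleton]
    have hXZ := Q.isometry_X_Z hO j (x j)
    by_cases hji : j = i
    · subst hji
      simpa [pick_one] using hXZ.1
    · by_cases hadj : G.Adj j i
      · simpa [hji, hadj, pick_neg_one] using hXZ.2
      · simp [hji, hadj, pick_zero]
  have hgs := eq_graphState_smul hflip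
  refine ⟨((√2 ^ Fintype.card V : ℝ) : ℂ) • w 0, ?_, fun m a => ?_⟩
  · rw [← sum_norm_tensorOp_sq W hW ψ]
    have h1 : ∀ a : V → Fin 2, ‖tensorOp (fun i => W i (a i)) ψ‖ ^ 2 =
        ‖graphState G a‖ ^ 2 * ‖((√2 ^ Fintype.card V : ℝ) : ℂ) • w 0‖ ^ 2 := by
      intro a
      rw [← mul_pow, ← norm_smul, ← hgs a]
    rw [Finset.sum_congr rfl fun a _ => h1 a, ← Finset.sum_mul, sum_norm_graphState_sq, one_mul]
  · have h1 : tensorOp (fun i => W i (a i)) (Q.obs m ψ) =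
        tensorOp (fun i => ∑ b, refObs AC i (m i) (a i) b • W i b) ψ := by
      rw [obs, ← mul_apply_eq_comp, ← tensorOp_mul]
      exact tensorOp_apply_congr fun i => hO i (m i) (a i)
    rw [h1, tensorOp_sum_smul (fun i b => refObs AC i (m i) (a i) b) W, sum_apply, refVector,
      Finset.sum_smul]
    refine Finset.sum_congr rfl fun b _ => ?_
    rw [smul_apply, mul_smul, ← hgs b]

end Realization

end SelfTest

/-! ### The Bell inequality of a hub -/

section HubSelfTest

variable {V : Type} [Fintype V] [DecidableEq V] {G : SimpleGraph V}

namespace Realization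

variable (Q : Realization V)

theorem restOp_mul_self (T : V) (s : V → SignType) : Q.restOp T s * Q.restOp T s = 1 := by
  rw [restOp, obs, ← tensorOp_mul, ← tensorOp_one]
  congr 1
  ext1 i
  rw [Pi.mul_apply]
  rcases Function.update s T 0 i with _ | _ | _
  · simp [pick]
  · exact Q.B_sq i
  · exact Q.A_sq i

theorem restOp_localOp_comm (T : V) (s : V → SignType) (S : L2 (Q.κ T) →L[ℂ] L2 (Q.κ T))
    (ψ : L2 (∀ i, Q.κ i)) :
    Q.restOp T s (localOp T S ψ) = localOp T S (Q.restOp T s ψ) := by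
  rw [← mul_apply_eq_comp, restOp, obs, tensorOp_mul_localOp_comm _ _ (by simp [pick_zero]),
    mul_apply_eq_comp]

theorem pauliOp_eq_restOp (T : V) (s : V → SignType) (ψ : L2 (∀ i, Q.κ i)) :
    pauliOp (Q.X {T}) (Q.Z {T}) s ψ =
      Q.restOp T s (localOp T (pick 1 (Q.X {T} T) (Q.Z {T} T) (s T)) ψ) := by
  rw [pauliOp, tensorOp_eq_mul_localOp _ T, mul_apply_eq_comp, restOp, obs]
  congr 2
  ext1 i
  rcases eq_or_ne i T with rfl | h
  · simp [pick_zero]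
  · simp [X, Z, h]

/-- The rotated operators of a party square to the identity on a state only if its observables
anticommute there. -/
theorem anticomm_of_X_sq {AC : Finset V} {i : V} (hi : i ∈ AC) {ψ : L2 (∀ i, Q.κ i)}
    (h : localOp i (Q.X AC i * Q.X AC i) ψ = ψ) :
    localOp i (Q.A i * Q.B i + Q.B i * Q.A i) ψ = 0 := by
  have h2 := ofReal_inv_sqrt_two_mul_self
  have h3 : Q.A i * Q.B i + Q.B i * Q.A i = (2 : ℂ) • (Q.X AC i * Q.X AC i - 1) := by
    rw [X, if_pos hi, smul_mul_smul_comm, h2, mul_add, add_mul, add_mul, Q.A_sq, Q.B_sq]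
    module
  rw [h3, map_smul, map_sub, map_one, smul_apply, sub_apply, h, one_apply_eq_self, sub_self,
    smul_zero]

theorem X_mul_Z_add {AC : Finset V} {i : V} (hi : i ∈ AC) :
    Q.X AC i * Q.Z AC i + Q.Z AC i * Q.X AC i = 0 := by
  rw [X, Z, if_pos hi, if_pos hi, smul_mul_smul_comm, smul_mul_smul_comm, mul_sub, sub_mul, mul_add,
    add_mul, add_mul, mul_add, Q.A_sq, Q.B_sq]
  module

end Realization

namespace Hub

variable {K : ℕ} {c : G.Coloring (Fin K)} (h : Hub G c)

theorem quantum_bound_eq :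
    2 * √2 * (h.construction.P.card : ℝ) + h.construction.R.card =
      2 * √2 * h.construction.P.card := by
  simp [construction]

/-- In a realization that reaches the quantum bound, `X` and `Z` of the hub act on the state like
the remaining parts of the stabilizers. -/
theorem pick_eq_restOp [Nontrivial V] (hG : G.Connected) (Q : Realization V)
    (hQ : Q.value h.construction.bell = 2 * √2 * h.construction.P.card) (e : Q.E) (i : V) :
    localOp h.T (pick 1 (Q.X {h.T} h.T) (Q.Z {h.T} h.T) (stabSeq G (h.gens i) h.T)) (Q.ψ e) =
      Q.restOp h.T (stabSeq G (h.gens i)) (Q.ψ e) := by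
  rw [← quantum_bound_eq] at hQ
  have hpair : ∀ i j, c i = c h.T → c j ≠ c h.T →
      localOp h.T (Q.X {h.T} h.T) (Q.ψ e) = Q.restOp h.T (stabSeq G (h.gens i)) (Q.ψ e) ∧
      localOp h.T (Q.Z {h.T} h.T) (Q.ψ e) = Q.restOp h.T (stabSeq G (h.gens j)) (Q.ψ e) := by
    intro i j hi hj
    refine Q.eq_restOp_of_value_eq h.construction hQ (p := (h.gens i, h.gens j)) ?_
      (Finset.mem_singleton_self h.T) (h.stabSeq_gens_of_eq hi) (h.stabSeq_gens_of_ne hj) ?_ e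
    · exact Finset.mem_product.mpr ⟨Finset.mem_image_of_mem _ (by simpa [sameColour] using hi),
        Finset.mem_image_of_mem _ (by simpa [otherColour] using hj)⟩
    · intro k hk hkT
      exact absurd (Finset.mem_singleton.mp hk) hkT
  by_cases hi : c i = c h.T
  · obtain ⟨j, hj⟩ := h.otherColour_nonempty hG
    rw [h.stabSeq_gens_of_eq hi, pick_one]
    exact (hpair i j hi (Finset.mem_filter.mp hj).2).1
  · rw [h.stabSeq_gens_of_ne hi, pick_neg_one]
    exact (hpair h.T i rfl hi).2

/-- A state that is stabilized, with the rotated operators of the hub in the roles of `X` and `Z`,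
attains the quantum bound. -/
theorem value_eq_of_stabilizes (Q : Realization V)
    (hψ : ∀ e i, pauliOp (Q.X {h.T}) (Q.Z {h.T}) (stabSeq G (h.gens i)) (Q.ψ e) = Q.ψ e) :
    Q.value h.construction.bell = 2 * √2 * h.construction.P.card := by
  have hrest : ∀ e i, localOp h.T (pick 1 (Q.X {h.T} h.T) (Q.Z {h.T} h.T)
      (stabSeq G (h.gens i) h.T)) (Q.ψ e) = Q.restOp h.T (stabSeq G (h.gens i)) (Q.ψ e) := by
    intro e i
    have h1 := hψ e i
    rw [Q.pauliOp_eq_restOp] at h1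
    conv_rhs => rw [← h1]
    rw [← mul_apply_eq_comp (Q.restOp _ _), Q.restOp_mul_self, one_apply_eq_self]
  have hpair : ∀ e, ∀ p ∈ h.construction.P,
      (inner ℂ (Q.ψ e) (Q.bellOp (termCoeff {h.T} (stabSeq G p.1)) (Q.ψ e))).re +
        (inner ℂ (Q.ψ e) (Q.bellOp (termCoeff {h.T} (stabSeq G p.2)) (Q.ψ e))).re =
      2 * √2 * ‖Q.ψ e‖ ^ 2 := by
    intro e p hp
    obtain ⟨i, hi, hi'⟩ := Finset.mem_image.mp (Finset.mem_product.mp hp).1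
    obtain ⟨j, hj, hj'⟩ := Finset.mem_image.mp (Finset.mem_product.mp hp).2
    have h1 := h.stabSeq_gens_of_eq (Finset.mem_filter.mp hi).2
    have h2 := h.stabSeq_gens_of_ne (Finset.mem_filter.mp hj).2
    have hri := hrest e i
    have hrj := hrest e j
    rw [h1, pick_one] at hri
    rw [h2, pick_neg_one] at hrj
    have hd := Q.pair_deficit (AC := {h.T}) (Finset.mem_singleton_self h.T) h1 h2
      (fun k hk hkT => absurd (Finset.mem_singleton.mp hk) hkT) (Q.ψ e)
    rw [hri, hrj, sub_self, sub_self, norm_zero] at hd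
    rw [← hi', ← hj']
    linarith
  refine (Q.hasSum_value h.construction.bell).unique ?_
  have hs := Q.norm_ψ.mul_left (2 * √2 * h.construction.P.card)
  rw [mul_one] at hs
  refine hs.congr_fun fun e => ?_
  rw [Q.inner_bellOp, show h.construction.R = ∅ from rfl,
    show h.construction.AC = {h.T} from rfl, Finset.sum_empty, add_zero,
    Finset.sum_congr rfl (hpair e), Finset.sum_const, nsmul_eq_mul]
  ring

theorem selfTests_of_isGreatest [Nontrivial V] (hG : G.Connected)
    (hmax : IsGreatest (quantumValues h.construction.bell) (2 * √2 * h.construction.P.card)) :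
    SelfTests h.construction.bell G {h.T} := by
  intro Q hQ
  have hval := hQ.unique hmax
  obtain ⟨W, hW⟩ := Q.exists_isometries {h.T}
  have hself : ∀ e, ∃ extra : L2 (∀ i, Q.κ i), ‖extra‖ ^ 2 = ‖Q.ψ e‖ ^ 2 ∧
      ∀ m a, tensorOp (fun i => W i (a i)) (Q.obs m (Q.ψ e)) =
        refVector G {h.T} m a • extra := by
    intro e
    have hpick := h.pick_eq_restOp hG Q hval e
    have hsq : ∀ i, localOp h.T (pick 1 (Q.X {h.T} h.T) (Q.Z {h.T} h.T)
        (stabSeq G (h.gens i) h.T) * pick 1 (Q.X {h.T} h.T) (Q.Z {h.T} h.T)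
        (stabSeq G (h.gens i) h.T)) (Q.ψ e) = Q.ψ e := by
      intro i
      rw [map_mul, mul_apply_eq_comp, hpick, ← Q.restOp_localOp_comm, hpick, ← mul_apply_eq_comp,
        Q.restOp_mul_self, one_apply_eq_self]
    have hX : ∀ i, localOp i (Q.X {h.T} i * Q.X {h.T} i) (Q.ψ e) = Q.ψ e := by
      intro i
      by_cases hi : i = h.T
      · subst hi
        have := hsq h.T
        rwa [h.stabSeq_gens_of_eq rfl, pick_one] at this
      · simp [Realization.X, hi, Q.A_sq]
    have hZ : ∀ i, localOp i (Q.Z {h.T} i * Q.Z {h.T} i) (Q.ψ e) = Q.ψ e := by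
      intro i
      by_cases hi : i = h.T
      · subst hi
        obtain ⟨j, hj⟩ := h.otherColour_nonempty hG
        have := hsq j
        rwa [h.stabSeq_gens_of_ne (Finset.mem_filter.mp hj).2, pick_neg_one] at this
      · simp [Realization.Z, hi, Q.B_sq]
    have hg : ∀ i, pauliOp (Q.X {h.T}) (Q.Z {h.T}) (stabSeq G {i}) (Q.ψ e) = Q.ψ e := by
      refine (h.stabilizes_iff hX hZ).mp fun i => ?_
      rw [Q.pauliOp_eq_restOp, hpick, ← mul_apply_eq_comp, Q.restOp_mul_self, one_apply_eq_self]
    have hanti : ∀ i, localOp i (Q.A i * Q.B i + Q.B i * Q.A i) (Q.ψ e) = 0 := by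
      intro i
      by_cases hi : i = h.T
      · exact Q.anticomm_of_X_sq (Finset.mem_singleton.mpr hi) (hX i)
      · have := anticomm_of_connected hG hX hZ hg (T := h.T)
          (by rw [Q.X_mul_Z_add (Finset.mem_singleton_self _), map_zero, zero_apply]) i
        simpa [Realization.X, Realization.Z, hi] using this
    refine Q.selfTest_of_stabilizes (fun i => (hW i).1) (fun i s a => ?_) hg
    obtain ⟨R, hR⟩ := (hW i).2 s a
    rw [hR, map_add, add_apply, map_mul, mul_apply_eq_comp, hanti, map_zero, add_zero]
  choose extra hnorm hextra using hself
  refine ⟨W, extra, fun i v => ?_, ?_, fun m e a => hextra e m a⟩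
  · have h1 : ∀ T : L2 (Q.κ i) →L[ℂ] L2 (Q.κ i),
        ‖T v‖ ^ 2 = (inner ℂ v ((star T * T) v)).re := by
      intro T
      rw [mul_apply_eq_comp, ContinuousLinearMap.star_eq_adjoint,
        ContinuousLinearMap.adjoint_inner_right]
      exact (inner_self_eq_norm_sq (𝕜 := ℂ) _).symm
    have h2 := (hW i).1
    rw [Fin.sum_univ_two] at h2
    rw [h1, h1, ← Complex.add_re, ← inner_add_right, ← add_apply, h2, one_apply_eq_self]
    exact inner_self_eq_norm_sq (𝕜 := ℂ) v
  · simpa only [hnorm] using Q.norm_ψ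

end Hub

end HubSelfTest

/-! ### The reference realization -/

section Reference

variable {V : Type} [Fintype V] [DecidableEq V] {G : SimpleGraph V}

/-- Complex `2 × 2` matrices as operators on the Hilbert space of a qubit. -/
def matrixOp : Matrix (Fin 2) (Fin 2) ℂ ≃⋆ₐ[ℂ] (L2 (Fin 2) →L[ℂ] L2 (Fin 2)) :=
  Matrix.toEuclideanCLM.trans (lpPiLpₗᵢ (fun _ : Fin 2 => ℂ) ℂ).symm.conjStarAlgEquiv

theorem matrixOp_apply (M : Matrix (Fin 2) (Fin 2) ℂ) (v : L2 (Fin 2)) (a : Fin 2) :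
    matrixOp M v a = ∑ b, M a b * v b := rfl

theorem matrixOp_single (M : Matrix (Fin 2) (Fin 2) ℂ) (a b : Fin 2) :
    matrixOp M (lp.single 2 b (1 : ℂ)) a = M a b := by
  rw [matrixOp_apply, Finset.sum_eq_single b]
  · simp
  · intro d _ hd
    rw [lp.single_apply_ne _ _ _ hd, mul_zero]
  · simp

theorem tensorOp_matrixOp (M : V → Matrix (Fin 2) (Fin 2) ℂ) (f : L2 (V → Fin 2))
    (a : V → Fin 2) :
    tensorOp (κ := fun _ => Fin 2) (fun i => matrixOp (M i)) f a =
      ∑ b : V → Fin 2, (∏ i, M i (a i) (b i)) * f b := by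
  have hf : f = ∑ b, f b • lp.single 2 b (1 : ℂ) := by
    ext x
    rw [lp.coeFn_sum, Finset.sum_apply, Finset.sum_eq_single x]
    · simp
    · intro b _ hb
      rw [lp.coeFn_smul, Pi.smul_apply, lp.single_apply_ne _ _ _ hb.symm, smul_zero]
    · simp
  conv_lhs => rw [hf]
  rw [map_sum, lp.coeFn_sum, Finset.sum_apply]
  refine Finset.sum_congr rfl fun b _ => ?_
  rw [map_smul, lp.coeFn_smul, Pi.smul_apply, tensorOp_single, smul_eq_mul, mul_comm]
  simp only [matrixOp_single]

theorem pauliX_mul_self : pauliX * pauliX = 1 := by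
  ext a b; fin_cases a <;> fin_cases b <;> simp [pauliX]

theorem pauliZ_mul_self : pauliZ * pauliZ = 1 := by
  ext a b; fin_cases a <;> fin_cases b <;> simp [pauliZ]

theorem star_pauliX : star pauliX = pauliX := by
  ext a b; fin_cases a <;> fin_cases b <;> simp [pauliX, Matrix.star_apply]

theorem star_pauliZ : star pauliZ = pauliZ := by
  ext a b; fin_cases a <;> fin_cases b <;> simp [pauliZ, Matrix.star_apply]

theorem pauliX_mul_pauliZ : pauliX * pauliZ = -(pauliZ * pauliX) := by
  ext a b; fin_cases a <;> fin_cases b <;> simp [pauliX, pauliZ]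

theorem refObs_spec (AC : Finset V) (i : V) (s : SignType) :
    star (refObs AC i s) = refObs AC i s ∧ refObs AC i s * refObs AC i s = 1 := by
  have h2 := ofReal_inv_sqrt_two_mul_self
  unfold refObs
  split_ifs <;> rcases s with _ | _ | _ <;>
    simp only [pick, star_one, one_mul, star_pauliX, star_pauliZ, pauliX_mul_self, pauliZ_mul_self,
      and_self, star_smul, star_sub, star_add, Complex.star_def, Complex.conj_ofReal, true_and,
      smul_mul_smul_comm, h2, mul_add, add_mul, mul_sub, sub_mul, pauliX_mul_pauliZ] <;> module

/-- The realization by the graph state and the reference observables. -/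
abbrev refRealization (G : SimpleGraph V) (AC : Finset V) : Realization V where
  κ := fun _ => Fin 2
  E := Unit
  ψ := fun _ => ⟨graphState G, Memℓp.all _⟩
  norm_ψ := by
    have h1 := (hasSum_sq _ (⟨graphState G, Memℓp.all _⟩ : L2 (V → Fin 2))).unique
      (hasSum_fintype _)
    have h2 : ∑ x, ‖graphState G x‖ ^ 2 = 1 := sum_norm_graphState_sq
    rw [show ‖(⟨graphState G, Memℓp.all _⟩ : L2 (V → Fin 2))‖ ^ 2 = 1 from h1.trans h2]
    exact hasSum_unique fun _ : Unit => (1 : ℝ)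
  A := fun i => matrixOp (refObs AC i 1)
  B := fun i => matrixOp (refObs AC i (-1))
  A_selfAdjoint := fun i => by
    rw [IsSelfAdjoint, ← map_star, (refObs_spec AC i 1).1]
  B_selfAdjoint := fun i => by
    rw [IsSelfAdjoint, ← map_star, (refObs_spec AC i (-1)).1]
  A_sq := fun i => by rw [← map_mul, (refObs_spec AC i 1).2, map_one]
  B_sq := fun i => by rw [← map_mul, (refObs_spec AC i (-1)).2, map_one]

theorem refRealization_X (AC : Finset V) (i : V) :
    (refRealization G AC).X AC i = matrixOp pauliX := by
  have h2 := ofReal_inv_sqrt_two_mul_self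
  by_cases hi : i ∈ AC
  · simp only [Realization.X, refRealization, refObs, if_pos hi, pick_one, pick_neg_one]
    rw [← map_add, ← map_smul, ← smul_add, smul_smul, h2]
    congr 1
    module
  · simp only [Realization.X, refRealization, refObs, if_neg hi, pick_one]

theorem refRealization_Z (AC : Finset V) (i : V) :
    (refRealization G AC).Z AC i = matrixOp pauliZ := by
  have h2 := ofReal_inv_sqrt_two_mul_self
  by_cases hi : i ∈ AC
  · simp only [Realization.Z, refRealization, refObs, if_pos hi, pick_one, pick_neg_one]
    rw [← map_sub, ← map_smul, ← smul_sub, smul_smul, h2]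
    congr 1
    module
  · simp only [Realization.Z, refRealization, refObs, if_neg hi, pick_neg_one]

/-- The generators stabilize the graph state. -/
theorem pauliOp_graphState (i : V) :
    pauliOp (κ := fun _ => Fin 2) (fun _ => matrixOp pauliX) (fun _ => matrixOp pauliZ)
      (stabSeq G {i}) ⟨graphState G, Memℓp.all _⟩ = ⟨graphState G, Memℓp.all _⟩ := by
  classical
  have h1 : (fun j => pick 1 (matrixOp pauliX) (matrixOp pauliZ) (stabSeq G {i} j)) =
      fun j => matrixOp (pick 1 pauliX pauliZ (stabSeq G {i} j)) := by
    ext1 j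
    rcases stabSeq G {i} j with _ | _ | _ <;> simp [pick]
  ext a
  rw [pauliOp, h1, tensorOp_matrixOp, Finset.sum_eq_single (Function.update a i (a i + 1))]
  · have h2 : ∀ j, pick 1 pauliX pauliZ (stabSeq G {i} j) (a j)
        (Function.update a i (a i + 1) j) = if G.Adj j i then zSign (a j) else 1 := by
      intro j
      rw [stabSeq_singleton]
      by_cases hj : j = i
      · subst hj
        simp only [if_true, pick_one, Function.update_self, SimpleGraph.irrefl, if_false]
        generalize a j = b
        fin_cases b <;> simp [pauliX]
      · rw [if_neg hj, Function.update_of_ne hj]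
        split_ifs
        · rw [pick_neg_one]
          generalize a j = b
          fin_cases b <;> simp [pauliZ, zSign]
        · simp [pick_zero]
    rw [Finset.prod_congr rfl fun j _ => h2 j]
    show flipSign G i a * graphState G (Function.update a i (a i + 1)) = graphState G a
    have h3 : graphState G (Function.update a i (a i + 1)) = flipSign G i a * graphState G a :=
      graphState_flip a i
    rw [h3, ← mul_assoc, flipSign_mul_self, one_mul]
  -- `X` is antidiagonal while `Z` and `1` are diagonal, so the other entries of row `a` vanish.
  · intro b _ hb
    obtain ⟨j, hj⟩ := Function.ne_iff.mp hb
    rw [Finset.prod_eq_zero (Finset.mem_univ j), zero_mul]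
    rw [stabSeq_singleton]
    by_cases hji : j = i
    · subst hji
      rw [Function.update_self] at hj
      rw [if_pos rfl, pick_one]
      revert hj
      generalize a j = x
      generalize b j = y
      fin_cases x <;> fin_cases y <;> simp [pauliX]
    · rw [Function.update_of_ne hji] at hj
      rw [if_neg hji]
      split_ifs
      · rw [pick_neg_one]
        revert hj
        generalize a j = x
        generalize b j = y
        fin_cases x <;> fin_cases y <;> simp [pauliZ]
      · rw [pick_zero, Matrix.one_apply_ne hj.symm]
  · simp

/-- The graph state with the reference observables attains the quantum bound. -/
theorem Hub.value_refRealization {K : ℕ} {c : G.Coloring (Fin K)} (h : Hub G c) :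
    (refRealization G {h.T}).value h.construction.bell = 2 * √2 * h.construction.P.card := by
  have hX2 : matrixOp pauliX * matrixOp pauliX = 1 := by
    rw [← map_mul, pauliX_mul_self, map_one]
  have hZ2 : matrixOp pauliZ * matrixOp pauliZ = 1 := by
    rw [← map_mul, pauliZ_mul_self, map_one]
  have hX : (refRealization G {h.T}).X {h.T} = fun _ => matrixOp pauliX :=
    funext (refRealization_X _)
  have hZ : (refRealization G {h.T}).Z {h.T} = fun _ => matrixOp pauliZ :=
    funext (refRealization_Z _)
  refine h.value_eq_of_stabilizes _ fun e i => ?_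
  rw [hX, hZ]
  exact (h.stabilizes_iff (fun i => by rw [hX2, map_one, one_apply_eq_self])
    (fun i => by rw [hZ2, map_one, one_apply_eq_self])).mpr pauliOp_graphState i

theorem Hub.isGreatest_quantumValues {K : ℕ} {c : G.Coloring (Fin K)} (h : Hub G c) :
    IsGreatest (quantumValues h.construction.bell) (2 * √2 * h.construction.P.card) := by
  refine ⟨⟨_, h.value_refRealization⟩, ?_⟩
  rintro _ ⟨Q, rfl⟩
  rw [← h.quantum_bound_eq]
  exact Q.value_le h.construction

end Reference

/-! ### The classical bound and the number of correlators -/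

section Classical

variable {V : Type} [Fintype V] [DecidableEq V] {G : SimpleGraph V}

/-- The value of a Bell expression for a deterministic strategy. -/
def deterministicValue (β : BellExpr V) (l : V → ℤˣ × ℤˣ) : ℝ :=
  ∑ m, β m * ∏ i, pick 1 (((l i).1 : ℤ) : ℝ) (((l i).2 : ℤ) : ℝ) (m i)

theorem isGreatest_classicalValues {β : BellExpr V} {v : ℝ}
    (hle : ∀ l, deterministicValue β l ≤ v) (hex : ∃ l, deterministicValue β l = v) :
    IsGreatest (classicalValues β) v := by
  classical
  constructor
  · obtain ⟨l, hl⟩ := hex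
    refine ⟨Pi.single l 1, single_mem_stdSimplex ℝ l, ?_⟩
    rw [Finset.sum_eq_single l]
    · rw [Pi.single_eq_same, one_mul]; exact hl.symm
    · intro l' _ hl'
      rw [Pi.single_eq_of_ne hl', zero_mul]
    · simp
  · rintro _ ⟨p, hp, rfl⟩
    calc ∑ l, p l * deterministicValue β l ≤ ∑ l, p l * v :=
          Finset.sum_le_sum fun l _ => mul_le_mul_of_nonneg_left (hle l) (hp.1 l)
      _ = v := by rw [← Finset.sum_mul, hp.2, one_mul]

open scoped Classical in
theorem deterministicValue_termCoeff (AC : Finset V) (s : V → SignType) (l : V → ℤˣ × ℤˣ) :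
    deterministicValue (termCoeff AC s) l =
      ∏ i, if i ∈ AC ∧ s i ≠ 0 then (((l i).1 : ℤ) : ℝ) + (s i : ℝ) * (((l i).2 : ℤ) : ℝ)
        else pick 1 (((l i).1 : ℤ) : ℝ) (((l i).2 : ℤ) : ℝ) (s i) := by
  have h1 : ∀ i, (if i ∈ AC ∧ s i ≠ 0 then (((l i).1 : ℤ) : ℝ) + (s i : ℝ) * (((l i).2 : ℤ) : ℝ)
        else pick 1 (((l i).1 : ℤ) : ℝ) (((l i).2 : ℤ) : ℝ) (s i)) =
      ∑ σ : SignType, (if i ∈ AC ∧ s i ≠ 0 then pick 0 1 (s i : ℝ) σ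
        else if σ = s i then 1 else 0) *
          pick 1 (((l i).1 : ℤ) : ℝ) (((l i).2 : ℤ) : ℝ) σ := by
    intro i
    split_ifs with h
    · simp only [SignType.univ_eq]
      simp [pick_zero, pick_one, pick_neg_one, add_comm]
    · simp
  rw [Finset.prod_congr rfl fun i _ => h1 i, Finset.prod_univ_sum, Fintype.piFinset_univ]
  refine Finset.sum_congr rfl fun m _ => ?_
  rw [Finset.prod_mul_distrib, termCoeff]

theorem abs_pick (a b : ℤˣ) (s : SignType) :
    |pick 1 ((a : ℤ) : ℝ) ((b : ℤ) : ℝ) s| = 1 := by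
  rcases Int.units_eq_one_or a with rfl | rfl <;> rcases Int.units_eq_one_or b with rfl | rfl <;>
    rcases s with _ | _ | _ <;> simp [pick]

theorem abs_deterministicValue_rest {AC : Finset V} {s : V → SignType} (h0 : ∀ i ∈ AC, s i = 0)
    (l : V → ℤˣ × ℤˣ) : |deterministicValue (termCoeff AC s) l| = 1 := by
  classical
  rw [deterministicValue_termCoeff, Finset.abs_prod]
  refine Finset.prod_eq_one fun i _ => ?_
  rw [if_neg fun h => h.2 (h0 i h.1), abs_pick]

theorem abs_deterministicValue_pair {AC : Finset V} {T : V} {s : V → SignType} (hT : T ∈ AC)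
    (hs : s T ≠ 0) (h0 : ∀ i ∈ AC, i ≠ T → s i = 0) (l : V → ℤˣ × ℤˣ) :
    |deterministicValue (termCoeff AC s) l| =
      |(((l T).1 : ℤ) : ℝ) + (s T : ℝ) * (((l T).2 : ℤ) : ℝ)| := by
  classical
  rw [deterministicValue_termCoeff, Finset.abs_prod, Finset.prod_eq_single T, if_pos ⟨hT, hs⟩]
  · intro i _ hi
    rw [if_neg fun h => h.2 (h0 i h.1 hi), abs_pick]
  · simp

/-- The maximal classical value: `2` for each pair of stabilizers, as one of `A + B` and `A - B`
vanishes for every deterministic strategy, and `1` for each other stabilizer. -/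
theorem Construction.isGreatest_classicalValues {K : ℕ} {c : G.Coloring (Fin K)}
    (C : Construction G c) :
    IsGreatest (classicalValues C.bell) (2 * C.P.card + C.R.card) := by
  classical
  have hbell : ∀ l, deterministicValue C.bell l =
      ∑ p ∈ C.P, (deterministicValue (termCoeff C.AC (stabSeq G p.1)) l +
        deterministicValue (termCoeff C.AC (stabSeq G p.2)) l) +
      ∑ D ∈ C.R, deterministicValue (termCoeff C.AC (stabSeq G D)) l := by
    intro l
    simp only [deterministicValue, Construction.bell, add_mul, Finset.sum_mul,
      Finset.sum_add_distrib]
    congr 1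
    · congr 1 <;> exact Finset.sum_comm
    · exact Finset.sum_comm
  refine StabBell.isGreatest_classicalValues (fun l => ?_) ⟨fun _ => 1, ?_⟩
  · have hP : ∀ p ∈ C.P, deterministicValue (termCoeff C.AC (stabSeq G p.1)) l +
        deterministicValue (termCoeff C.AC (stabSeq G p.2)) l ≤ 2 := by
      intro p hp
      obtain ⟨T, hT, h1, h2, h0⟩ := C.pair p hp
      have e1 := abs_deterministicValue_pair hT (by simp [h1]) (fun i hi h => (h0 i hi h).1) l
      have e2 := abs_deterministicValue_pair hT (by simp [h2]) (fun i hi h => (h0 i hi h).2) l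
      rw [h1] at e1
      rw [h2] at e2
      refine (add_le_add (le_abs_self _) (le_abs_self _)).trans ?_
      rw [e1, e2]
      rcases Int.units_eq_one_or (l T).1 with h3 | h3 <;>
        rcases Int.units_eq_one_or (l T).2 with h4 | h4 <;> rw [h3, h4] <;> norm_num
    have hR : ∀ D ∈ C.R, deterministicValue (termCoeff C.AC (stabSeq G D)) l ≤ 1 := by
      intro D hD
      rw [← abs_deterministicValue_rest (C.rest D hD) l]
      exact le_abs_self _
    have h1 := Finset.sum_le_sum hP
    have h2 := Finset.sum_le_sum hR
    simp only [Finset.sum_const, nsmul_eq_mul] at h1 h2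
    rw [hbell]
    linarith
  -- The strategy with all outcomes equal to `1`.
  · have hone : ∀ s : V → SignType, (∀ i ∈ C.AC, s i = 0) →
        deterministicValue (termCoeff C.AC s) (fun _ => 1) = 1 := by
      intro s hs
      rw [deterministicValue_termCoeff]
      refine Finset.prod_eq_one fun i _ => ?_
      rw [if_neg fun h => h.2 (hs i h.1)]
      rcases s i with _ | _ | _ <;> simp [pick]
    have hP : ∀ p ∈ C.P, deterministicValue (termCoeff C.AC (stabSeq G p.1)) (fun _ => 1) +
        deterministicValue (termCoeff C.AC (stabSeq G p.2)) (fun _ => 1) = 2 := by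
      intro p hp
      obtain ⟨T, hT, h1, h2, h0⟩ := C.pair p hp
      rw [deterministicValue_termCoeff, deterministicValue_termCoeff,
        Finset.prod_eq_single T, Finset.prod_eq_zero (Finset.mem_univ T)]
      · simp [hT, h1]; norm_num
      · simp [hT, h2]
      · intro i _ hi
        rw [if_neg fun h => h.2 (h0 i h.1 hi).1]
        rcases stabSeq G p.1 i with _ | _ | _ <;> simp [pick]
      · simp
    rw [hbell, Finset.sum_congr rfl hP, Finset.sum_congr rfl fun D hD => hone _ (C.rest D hD)]
    simp [mul_comm]

end Classical

section Count

variable {V : Type} [Fintype V] [DecidableEq V] {G : SimpleGraph V}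

theorem termCoeff_ne_zero_iff {T : V} {s m : V → SignType} (hs : s T ≠ 0) :
    termCoeff {T} s m ≠ 0 ↔ (∀ i, i ≠ T → m i = s i) ∧ m T ≠ 0 := by
  classical
  rw [termCoeff, Finset.prod_ne_zero_iff]
  constructor
  · intro h
    refine ⟨fun i hi => ?_, fun hm => ?_⟩
    · by_contra hne
      exact h i (Finset.mem_univ i) (by simp [hi, hne])
    · exact h T (Finset.mem_univ T) (by simp [hs, hm, pick_zero])
  · rintro ⟨h1, h2⟩ i -
    by_cases hi : i = T
    · subst hi
      rw [if_pos ⟨Finset.mem_singleton_self _, hs⟩]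
      generalize m i = a at h2
      generalize s i = b at hs
      rcases a with _ | _ | _ <;> rcases b with _ | _ | _ <;> simp_all [pick]
    · simp [hi, h1 i hi]

namespace Hub

variable {K : ℕ} {c : G.Coloring (Fin K)} (h : Hub G c)

theorem stabSeq_gens_ne_zero (i : V) : stabSeq G (h.gens i) h.T ≠ 0 := by
  by_cases hi : c i = c h.T
  · simp [h.stabSeq_gens_of_eq hi]
  · simp [h.stabSeq_gens_of_ne hi]

/-- No cancellation: a correlator occurs in the term of at most one stabilizer. -/
theorem bell_ne_zero_iff [Nontrivial V] (hG : G.Connected) (m : V → SignType) :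
    h.construction.bell m ≠ 0 ↔
      ∃ i, (∀ j, j ≠ h.T → m j = stabSeq G (h.gens i) j) ∧ m h.T ≠ 0 := by
  rw [h.bell_eq]
  constructor
  · intro hne
    obtain ⟨i, -, hi⟩ := Finset.exists_ne_zero_of_sum_ne_zero hne
    exact ⟨i, (termCoeff_ne_zero_iff (h.stabSeq_gens_ne_zero i)).mp (right_ne_zero_of_mul hi)⟩
  · rintro ⟨i, hi⟩
    rw [Finset.sum_eq_single i]
    · refine mul_ne_zero ?_ ((termCoeff_ne_zero_iff (h.stabSeq_gens_ne_zero i)).mpr hi)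
      have h1 := h.sameColour_nonempty.card_pos
      have h2 := (h.otherColour_nonempty hG).card_pos
      split_ifs
      · exact_mod_cast h2.ne'
      · exact_mod_cast h1.ne'
    · intro j _ hji
      by_contra hne
      have hj := (termCoeff_ne_zero_iff (h.stabSeq_gens_ne_zero j)).mp (right_ne_zero_of_mul hne)
      exact hji (h.eq_of_stabSeq_gens fun k hk => by rw [← hj.1 k hk, ← hi.1 k hk])
    · simp

theorem numCorrelators_eq [Nontrivial V] (hG : G.Connected) :
    h.construction.bell.numCorrelators = 2 * Fintype.card V := by
  let f : V × Bool → V → SignType := fun p =>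
    Function.update (stabSeq G (h.gens p.1)) h.T (if p.2 then 1 else -1)
  have hf : Function.Injective f := by
    rintro ⟨i, b⟩ ⟨j, d⟩ hij
    have h1 : i = j := h.eq_of_stabSeq_gens fun k hk => by
      have := congrFun hij k
      simpa [f, hk] using this
    have h2 := congrFun hij h.T
    simp only [f, Function.update_self] at h2
    refine Prod.ext h1 ?_
    cases b <;> cases d <;> simp at h2 ⊢
  have hset : {m | h.construction.bell m ≠ 0} = f '' Set.univ := by
    ext m
    simp only [Set.mem_ofPred_eq, h.bell_ne_zero_iff hG, Set.image_univ, Set.mem_range]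
    constructor
    · rintro ⟨i, h1, h2⟩
      refine ⟨(i, decide (m h.T = 1)), ?_⟩
      ext1 k
      by_cases hk : k = h.T
      · subst hk
        simp only [f, Function.update_self]
        generalize m h.T = a at h2
        rcases a with _ | _ | _
        · exact absurd rfl h2
        · rfl
        · rfl
      · simp only [f, Function.update_of_ne hk, h1 k hk]
    · rintro ⟨⟨i, b⟩, rfl⟩
      refine ⟨i, fun k hk => by simp [f, hk], ?_⟩
      simp only [f, Function.update_self]
      cases b <;> simp
  rw [BellExpr.numCorrelators, hset, Set.ncard_image_of_injective _ hf, Set.ncard_univ,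
    Nat.card_eq_fintype_card, Fintype.card_prod, Fintype.card_bool, mul_comm]

end Hub

end Count

end StabBell

end

open StabBell in
/-- For every graph state of a connected graph on at least two vertices and every colouring with
the minimal number of colours, some Bell inequality of the framework uses `2N` correlators, has
quantum-to-classical ratio `√2`, which no Bell inequality of the framework exceeds, and self-tests
the graph state. -/
theorem corollary1 {V : Type} [Fintype V] [DecidableEq V] [Nontrivial V] (G : SimpleGraph V)
    (hG : G.Connected) (K : ℕ) (hK : G.chromaticNumber = (K : ℕ∞)) (c : G.Coloring (Fin K)) :
    (∃ C : Construction G c,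
      C.bell.numCorrelators = 2 * Fintype.card V ∧
      (∃ βC βQ : ℝ, IsGreatest (classicalValues C.bell) βC ∧
        IsGreatest (quantumValues C.bell) βQ ∧ 0 < βC ∧ βQ / βC = √2) ∧
      SelfTests C.bell G C.AC) ∧
    ∀ (K' : ℕ) (c' : G.Coloring (Fin K')) (C' : Construction G c') (βC βQ : ℝ),
      IsGreatest (classicalValues C'.bell) βC → IsGreatest (quantumValues C'.bell) βQ →
        βQ ≤ √2 * βC := by
  constructor
  · obtain ⟨h⟩ := exists_hub hK c
    have hpos : 0 < (h.construction.P.card : ℝ) := by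
      rw [h.card_P]
      exact_mod_cast Nat.mul_pos h.sameColour_nonempty.card_pos (h.otherColour_nonempty hG).card_pos
    have hC := h.construction.isGreatest_classicalValues
    rw [show h.construction.R = ∅ from rfl, Finset.card_empty, Nat.cast_zero, add_zero] at hC
    refine ⟨h.construction, h.numCorrelators_eq hG,
      ⟨_, _, hC, h.isGreatest_quantumValues, by positivity, ?_⟩,
      h.selfTests_of_isGreatest hG h.isGreatest_quantumValues⟩
    field_simp
  · intro K' c' C' βC βQ hC hQ
    obtain ⟨Q, hQ'⟩ := hQ.1
    have h1 : βC = 2 * C'.P.card + C'.R.card := hC.unique C'.isGreatest_classicalValues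
    have h2 : Q.value C'.bell ≤ 2 * √2 * C'.P.card + C'.R.card := Q.value_le C'
    have h3 : (C'.R.card : ℝ) ≤ √2 * C'.R.card :=
      le_mul_of_one_le_left (Nat.cast_nonneg _) (Real.one_le_sqrt.mpr (by norm_num))
    rw [h1]
    have h4 : Q.value C'.bell = βQ := hQ'
    linarith
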